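/- A qubit channel is a completely positive trace preserving linear map $\Phi:\mathcal M_2(\mathbb C)\to\mathcal M_2(\mathbb C)$; let $\mathcal C_2$ be the convex set of qubit channels and let $\mathcal X\subset\mathcal C_2$ be the set of its extreme points (the extremal channels). A set $\mathcal F\subseteq\mathcal C_2$ is universal for a set $\tilde{\mathcal C}\subseteq\mathcal C_2$ if every $\Phi\in\tilde{\mathcal C}$ is a finite composition $\Phi=\Phi_n\circ\dots\circ\Phi_1$ $(n\ge1)$ with all $\Phi_i\in\mathcal F$. The transfer matrix $T_\Phi$ is the $4\times4$ matrix of $\Phi$ in the basis $\sigma_0=I,\sigma_1,\sigma_2,\sigma_3$ of Pauli matrices, and $\Phi$ is degenerate if $\det T_\Phi=0$. The pure outputs (PO) of $\Phi$ are the pure states (density matrices of rank one) that are images under $\Phi$ of density matrices; $\Phi$ is called 1PO (2PO) if it has exactly one (exactly two) pure outputs. Let $\mathcal U_2$ be the set of unitary channels $X\mapsto UXU^\dagger$. Channels $\Phi,\Psi$ are unitarily equivalent if $\Phi=\mathcal U\circ\Psi\circ\mathcal V$ with $\mathcal U,\mathcal V\in\mathcal U_2$. For $0\le\lambda<1$ let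 $\Phi_{1PO}(\lambda)$ be the map that acts on Bloch vectors by $(x,y,z)\mapsto(\lambda x,\lambda y,\lambda^2z+1-\lambda^2)$. For $0\le\theta<\omega<\pi/2$ let $\Phi_{2PO}(\omega,\theta)$ be the map that acts by $(x,y,z)\mapsto(\lambda_1x,\lambda_2y,\lambda_1\lambda_2z+t)$ with $$\lambda_1=\frac{\cos\omega}{\cos\theta},\qquad \lambda_2=\frac{\tan\theta}{\tan\omega},\qquad t=\frac{\cos^2\theta-\cos^2\omega}{\cos^2\theta\,\sin\omega}.$$ For $\varepsilon>0$ let $$\mathcal X_{1PO}(\varepsilon)=\{\Phi_{1PO}(\lambda):\ \lambda=0\ \text{ or }\ 0<\lambda<1,\ \lambda>1-\varepsilon\},$$ $$\mathcal X_{2PO}(\varepsilon)=\{\Phi_{2PO}(\omega,0):\ 0<\omega<\tfrac\pi2,\ \omega<\varepsilon\}\cup\{\Phi_{2PO}(\omega,\theta):\ 0<\theta<\omega<\tfrac\pi2,\ \omega-\theta<\varepsilon\}.$$ Theorem. For every $\varepsilon>0$ the set $\mathcal X(\varepsilon)=\mathcal U_2\cup\mathcal X_{1PO}(\varepsilon)\cup\mathcal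 X_{2PO}(\varepsilon)$ consists of channels and is universal for the set $\mathcal X$ of extremal qubit channels. Moreover, let $\mathcal F$ be a set of qubit channels that is universal for all of $\mathcal C_2$ (or, more generally, for some set $\tilde{\mathcal C}$ with $\mathcal X\subseteq\tilde{\mathcal C}\subseteq\mathcal C_2$). Then: 1. $\mathcal F$ contains a constant channel $X\mapsto(\operatorname{tr}X)\,\psi$ for some pure state $\psi$, and it is a degenerate 1PO extremal channel. Furthermore, for every $\varepsilon>0$: 2. for infinitely many $\lambda\in(0,1)$ with $\lambda>1-\varepsilon$, $\mathcal F$ contains a non-degenerate 1PO extremal channel unitarily equivalent to $\Phi_{1PO}(\lambda)$; 3. for infinitely many $\omega\in(0,\pi/2)$ with $\omega<\varepsilon$, $\mathcal F$ contains a degenerate 2PO extremal channel unitarily equivalent to $\Phi_{2PO}(\omega,0)$; 4. for infinitely many pairs $(\omega,\theta)$ with $0<\theta<\omega<\pi/2$ and $\omega-\theta<\varepsilon$, $\mathcal F$ contains a non-degenerate 2PO extremal channel unitarily equivalent to $\Phi_{2PO}(\omega,\theta)$. -/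

import Mathlib

namespace QubitChannel

open scoped ComplexOrder

/-- The algebra of complex `2 × 2` matrices. -/
abbrev M2 : Type := Matrix (Fin 2) (Fin 2) ℂ

/-- Complete positivity: for every `k`, applying `Φ` to all blocks of a positive semidefinite
`k × k` block matrix with `2 × 2` blocks yields a positive semidefinite matrix, that is,
`id_k ⊗ Φ` is a positive map. -/
def IsCompletelyPositive (Φ : M2 →ₗ[ℂ] M2) : Prop :=
  ∀ (k : ℕ) (A : Matrix (Fin k) (Fin k) M2),
    (Matrix.comp (Fin k) (Fin k) (Fin 2) (Fin 2) ℂ A).PosSemidef →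
      (Matrix.comp (Fin k) (Fin k) (Fin 2) (Fin 2) ℂ (A.map Φ)).PosSemidef

/-- The set of qubit channels: completely positive trace preserving linear maps. -/
def channels : Set (M2 →ₗ[ℂ] M2) :=
  {Φ | IsCompletelyPositive Φ ∧ ∀ X : M2, (Φ X).trace = X.trace}

/-- The extremal qubit channels: the extreme points of the convex set of qubit channels. -/
def extremalChannels : Set (M2 →ₗ[ℂ] M2) :=
  Set.extremePoints ℝ channels

/-- Density matrices: positive semidefinite matrices of trace one. -/
def densityMatrices : Set M2 :=
  {ρ | ρ.PosSemidef ∧ ρ.trace = 1}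

/-- Pure states: density matrices of rank one. -/
def pureStates : Set M2 :=
  {ρ | ρ ∈ densityMatrices ∧ ρ.rank = 1}

/-- The pure output of a map: the set of pure states among the images of density matrices. -/
def pureOutput (Φ : M2 →ₗ[ℂ] M2) : Set M2 :=
  (Φ '' densityMatrices) ∩ pureStates

/-- `F` is universal for the set of channels `T`: every element of `F` is a channel, and every
element of `T` is a composition of finitely many (at least one) elements of `F`.
The product of a list of endomorphisms is their composition. -/
def IsUniversalFor (F T : Set (M2 →ₗ[ℂ] M2)) : Prop :=
  F ⊆ channels ∧
    ∀ Φ ∈ T, ∃ l : List (Module.End ℂ M2), l ≠ [] ∧ (∀ Ψ ∈ l, Ψ ∈ F) ∧ Φ = l.prod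

/-- The map `X ↦ U X Uᴴ`. -/
def conjBy (U : M2) : M2 →ₗ[ℂ] M2 where
  toFun X := U * X * U.conjTranspose
  map_add' X Y := by rw [mul_add, add_mul]
  map_smul' c X := by simp

/-- The unitary channels `X ↦ U X Uᴴ` with `U` unitary. -/
def unitaryChannels : Set (M2 →ₗ[ℂ] M2) :=
  {Φ | ∃ U ∈ Matrix.unitaryGroup (Fin 2) ℂ, Φ = conjBy U}

/-- Two maps agree up to unitary conjugations of the input and of the output. -/
def UnitarilyEquivalent (Φ Ψ : M2 →ₗ[ℂ] M2) : Prop :=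
  ∃ U ∈ unitaryChannels, ∃ V ∈ unitaryChannels, Φ = U ∘ₗ Ψ ∘ₗ V

/-- The Pauli matrices, with `pauli 0` the identity matrix. -/
noncomputable def pauli : Fin 4 → M2 :=
  ![!![1, 0; 0, 1], !![0, 1; 1, 0], !![0, -Complex.I; Complex.I, 0], !![1, 0; 0, -1]]

/-- The real matrix `T` of `Φ` in the Pauli basis: if `Φ` is a channel, it sends
`(1/2) ∑ r_j σ_j` to `(1/2) ∑ r'_i σ_i` with `r' = T r`. -/
noncomputable def transferMatrix (Φ : M2 →ₗ[ℂ] M2) : Matrix (Fin 4) (Fin 4) ℝ :=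
  fun i j => ((pauli i * Φ (pauli j)).trace).re / 2

/-- A channel is degenerate if the determinant of its transfer matrix is zero. -/
def IsDegenerate (Φ : M2 →ₗ[ℂ] M2) : Prop :=
  (transferMatrix Φ).det = 0

/-- The linear map whose matrix in the Pauli basis is `T`. -/
noncomputable def ofTransferMatrix (T : Matrix (Fin 4) (Fin 4) ℝ) : M2 →ₗ[ℂ] M2 where
  toFun X := ∑ i, ∑ j, ((1 / 2 : ℂ) * (T i j : ℂ) * (pauli j * X).trace) • pauli i
  map_add' X Y := by
    simp only [mul_add, Matrix.trace_add, add_smul, Finset.sum_add_distrib]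
  map_smul' c X := by
    simp only [mul_smul_comm, Matrix.trace_smul, smul_eq_mul, Finset.smul_sum, smul_smul,
      RingHom.id_apply]
    refine Finset.sum_congr rfl fun i _ => Finset.sum_congr rfl fun j _ => ?_
    congr 1
    ring

/-- The map acting on Bloch vectors by
`(x, y, z) ↦ (a x, b y, c z + t)`. -/
noncomputable def diagonalForm (a b c t : ℝ) : M2 →ₗ[ℂ] M2 :=
  ofTransferMatrix !![1, 0, 0, 0; 0, a, 0, 0; 0, 0, b, 0; t, 0, 0, c]

/-- The constant channel `X ↦ (tr X) ρ`. -/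
def constantChannel (ρ : M2) : M2 →ₗ[ℂ] M2 where
  toFun X := X.trace • ρ
  map_add' X Y := by rw [Matrix.trace_add, add_smul]
  map_smul' c X := by simp [smul_smul]

/-- The standard one-pure-output channel: `(x, y, z) ↦ (λ x, λ y, λ² z + 1 - λ²)`. -/
noncomputable def onePO (lam : ℝ) : M2 →ₗ[ℂ] M2 :=
  diagonalForm lam lam (lam ^ 2) (1 - lam ^ 2)

/-- The standard two-pure-output channel, which maps the pure states with Bloch vectors
`(± cos θ, 0, sin θ)` to those with Bloch vectors `(± cos ω, 0, sin ω)`. Its diagonal entries are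
`cos ω / cos θ`, `tan θ / tan ω` and the product of these two. Used for `0 ≤ θ < ω < π / 2`. -/
noncomputable def twoPO (ω θ : ℝ) : M2 →ₗ[ℂ] M2 :=
  diagonalForm (Real.cos ω / Real.cos θ) (Real.tan θ / Real.tan ω)
    ((Real.cos ω / Real.cos θ) * (Real.tan θ / Real.tan ω))
    ((Real.cos θ ^ 2 - Real.cos ω ^ 2) / (Real.cos θ ^ 2 * Real.sin ω))

/-- Extremal channels with exactly one pure output, degenerate. -/
def extremal1POdeg : Set (M2 →ₗ[ℂ] M2) :=
  {Φ | Φ ∈ extremalChannels ∧ (∃ ξ, pureOutput Φ = {ξ}) ∧ IsDegenerate Φ}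

/-- Extremal channels with exactly one pure output, non-degenerate. -/
def extremal1POnd : Set (M2 →ₗ[ℂ] M2) :=
  {Φ | Φ ∈ extremalChannels ∧ (∃ ξ, pureOutput Φ = {ξ}) ∧ ¬ IsDegenerate Φ}

/-- Extremal channels with exactly two pure outputs, degenerate. -/
def extremal2POdeg : Set (M2 →ₗ[ℂ] M2) :=
  {Φ | Φ ∈ extremalChannels ∧ (∃ ξ ζ, ξ ≠ ζ ∧ pureOutput Φ = {ξ, ζ}) ∧ IsDegenerate Φ}

/-- Extremal channels with exactly two pure outputs, non-degenerate. -/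
def extremal2POnd : Set (M2 →ₗ[ℂ] M2) :=
  {Φ | Φ ∈ extremalChannels ∧ (∃ ξ ζ, ξ ≠ ζ ∧ pureOutput Φ = {ξ, ζ}) ∧ ¬ IsDegenerate Φ}

/-- The parameters in `(0, 1)` that lie within `ε` of `1`. -/
def params1POnd (ε : ℝ) : Set ℝ :=
  {lam | 0 < lam ∧ lam < 1 ∧ 1 - ε < lam}

/-- The parameters in `(0, π / 2)` that are smaller than `ε`. -/
def params2POdeg (ε : ℝ) : Set ℝ :=
  {ω | 0 < ω ∧ ω < Real.pi / 2 ∧ ω < ε}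

/-- The pairs `(ω, θ)` with `0 < θ < ω < π / 2` and `ω - θ < ε`. -/
def params2POnd (ε : ℝ) : Set (ℝ × ℝ) :=
  {p | 0 < p.2 ∧ p.2 < p.1 ∧ p.1 < Real.pi / 2 ∧ p.1 - p.2 < ε}

/-- The `ε`-small family of one-pure-output channels. -/
def family1PO (ε : ℝ) : Set (M2 →ₗ[ℂ] M2) :=
  onePO '' (params1POnd ε ∪ {0})

/-- The `ε`-small family of two-pure-output channels. -/
def family2PO (ε : ℝ) : Set (M2 →ₗ[ℂ] M2) :=
  (fun ω => twoPO ω 0) '' params2POdeg ε ∪ (fun p : ℝ × ℝ => twoPO p.1 p.2) '' params2POnd ε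

end QubitChannel

namespace QubitChannel

open scoped ComplexOrder
open Matrix

/-! Everything rests on tracking pure states through a channel. A channel that sends some mixed
state to a pure state is constant (`eq_constantChannel`). Hence if a composition has two distinct
pure outputs, pure preimages of them stay pure and distinct after every factor. On such pairs the
inner product of Bloch vectors cannot decrease (`blochInner_le`), and the inner products before and
after a channel determine it up to unitaries, unless the images are orthogonal
(`unitarilyEquivalent_of_pairs`). Both facts come from moving one state of each pair to the north
pole: channels fixing the pole form the family `poleMap b y s` with explicit positivity constraints
(`exists_poleMap`).

Classification (`extremal_classification`): the Choi matrix of an extremal channel has a kernel of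
dimension at least two, since otherwise it could be perturbed in both directions. Such a kernel
contains a product vector, that is, a pure state with pure image. The channel is then a `poleMap` up
to unitaries, and extremality saturates its constraints, which leaves unitary channels, `onePO` and
`twoPO`.

Sufficiency: both families divide into small pieces, by `onePO_pow` (parameters multiply) and
`twoPO_mul` (intervals of angles concatenate).

Necessity: a constant channel with pure value has a constant factor with pure value
(`exists_constantChannel_of_prod`). In a factorisation of `twoPO ω θ`, the first factor to raise the
inner product of the tracked pair starts at the angle θ and ends at some ω' ≤ ω
(`exists_twoPO_of_prod`). In a factorisation of `onePO lam`, all factors are equivalent to some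
`onePO` and their parameters multiply to lam, so one of them lies in [lam, 1)
(`exists_onePO_of_prod`). Letting these channels approach the identity or, for θ = 0, letting ω tend
to 0, gives infinitely many parameters. -/

/-! ### Choi matrices and complete positivity -/

/-- The Choi matrix of a linear map. -/
def choi (Φ : M2 →ₗ[ℂ] M2) : Matrix (Fin 2 × Fin 2) (Fin 2 × Fin 2) ℂ :=
  fun p q => Φ (Matrix.single p.1 q.1 1) p.2 q.2

/-- The linear map with a given Choi matrix. -/
def ofChoi (C : Matrix (Fin 2 × Fin 2) (Fin 2 × Fin 2) ℂ) : M2 →ₗ[ℂ] M2 where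
  toFun X := Matrix.of fun a b => ∑ i, ∑ j, X i j * C (i, a) (j, b)
  map_add' X Y := by
    ext a b
    simp only [Matrix.of_apply, Matrix.add_apply, add_mul, Finset.sum_add_distrib]
  map_smul' c X := by
    ext a b
    simp only [Matrix.of_apply, Matrix.smul_apply, smul_eq_mul, Finset.mul_sum, RingHom.id_apply,
      mul_assoc]

lemma ofChoi_apply (C : Matrix (Fin 2 × Fin 2) (Fin 2 × Fin 2) ℂ) (X : M2) (a b : Fin 2) :
    ofChoi C X a b = ∑ i, ∑ j, X i j * C (i, a) (j, b) := rfl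

lemma conjBy_apply (U X : M2) : conjBy U X = U * X * Uᴴ := rfl

lemma choi_apply (Φ : M2 →ₗ[ℂ] M2) (i a j b : Fin 2) :
    choi Φ (i, a) (j, b) = Φ (Matrix.single i j 1) a b := rfl

lemma apply_eq_sum (Φ : M2 →ₗ[ℂ] M2) (X : M2) :
    Φ X = X 0 0 • Φ (single 0 0 1) + X 0 1 • Φ (single 0 1 1) + X 1 0 • Φ (single 1 0 1)
      + X 1 1 • Φ (single 1 1 1) := by
  have h : X = X 0 0 • single 0 0 1 + X 0 1 • single 0 1 1 + X 1 0 • single 1 0 1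
      + X 1 1 • single 1 1 1 := by
    ext i j; fin_cases i <;> fin_cases j <;> simp [single]
  conv_lhs => rw [h]
  simp only [map_add, map_smul]

lemma ofChoi_choi (Φ : M2 →ₗ[ℂ] M2) : ofChoi (choi Φ) = Φ := by
  refine LinearMap.ext fun X => ?_
  rw [apply_eq_sum Φ X]
  ext a b
  simp [ofChoi_apply, choi_apply, Fin.sum_univ_two]
  ring

lemma choi_ofChoi (C : Matrix (Fin 2 × Fin 2) (Fin 2 × Fin 2) ℂ) : choi (ofChoi C) = C := by
  ext ⟨i, a⟩ ⟨j, b⟩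
  fin_cases i <;> fin_cases j <;> simp [ofChoi_apply, choi_apply, Fin.sum_univ_two, single]

lemma IsCompletelyPositive.one : IsCompletelyPositive (1 : Module.End ℂ M2) := fun k A hA => by
  exact hA

lemma IsCompletelyPositive.mul {Φ Ψ : Module.End ℂ M2} (hΦ : IsCompletelyPositive Φ)
    (hΨ : IsCompletelyPositive Ψ) : IsCompletelyPositive (Φ * Ψ) := fun k A hA => by
  have := hΦ k _ (hΨ k A hA)
  rwa [Matrix.map_map] at this

lemma IsCompletelyPositive.add {Φ Ψ : M2 →ₗ[ℂ] M2} (hΦ : IsCompletelyPositive Φ)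
    (hΨ : IsCompletelyPositive Ψ) : IsCompletelyPositive (Φ + Ψ) := fun k A hA => by
  have := (hΦ k _ hA).add (hΨ k A hA)
  exact this

lemma IsCompletelyPositive.zero : IsCompletelyPositive 0 := fun k A _ => by
  convert Matrix.PosSemidef.zero using 1
  rfl

lemma IsCompletelyPositive.sum {ι : Type*} (s : Finset ι) (Φ : ι → M2 →ₗ[ℂ] M2)
    (h : ∀ i ∈ s, IsCompletelyPositive (Φ i)) : IsCompletelyPositive (∑ i ∈ s, Φ i) :=
  Finset.sum_induction Φ IsCompletelyPositive (fun _ _ => .add) .zero h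

/-- On block matrices the map is conjugation by the block diagonal matrix with all blocks `K`. -/
lemma isCompletelyPositive_conjBy (K : M2) : IsCompletelyPositive (conjBy K) := fun k A hA => by
  have := hA.mul_mul_conjTranspose_same
    (Matrix.comp (Fin k) (Fin k) (Fin 2) (Fin 2) ℂ (Matrix.diagonal fun _ => K))
  convert this using 1
  have h1 : (Matrix.comp (Fin k) (Fin k) (Fin 2) (Fin 2) ℂ (Matrix.diagonal fun _ => K))ᴴ
      = Matrix.comp (Fin k) (Fin k) (Fin 2) (Fin 2) ℂ (Matrix.diagonal fun _ => Kᴴ) := by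
    ext ⟨i, a⟩ ⟨j, b⟩
    by_cases h : i = j
    · subst h; simp [Matrix.comp_apply]
    · simp [Matrix.comp_apply, Matrix.diagonal, h, Ne.symm h]
  rw [h1]
  simp only [← Matrix.compRingEquiv_apply, ← map_mul]
  congr 1
  ext i j : 2
  simp [conjBy_apply, Matrix.diagonal_mul, Matrix.mul_diagonal]

/-- The block matrix of matrix units is `v vᴴ` for the unnormalised maximally entangled vector `v`,
hence positive; the Choi matrix is its image. -/
lemma posSemidef_choi {Φ : M2 →ₗ[ℂ] M2} (h : IsCompletelyPositive Φ) : (choi Φ).PosSemidef := by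
  refine h 2 (Matrix.of fun i j => single i j 1) ?_
  convert posSemidef_vecMulVec_self_star (R := ℂ) (n := Fin 2 × Fin 2)
    (fun p => if p.1 = p.2 then 1 else 0) using 1
  ext ⟨i, a⟩ ⟨j, b⟩
  fin_cases i <;> fin_cases j <;> fin_cases a <;> fin_cases b <;>
    simp [Matrix.comp_apply, single, vecMulVec]

-- Factor the Choi matrix as `Bᴴ B`; each row of `B`, reshaped and conjugated, is a Kraus operator.
open scoped MatrixOrder Matrix.Norms.L2Operator in
lemma isCompletelyPositive_of_posSemidef_choi {Φ : M2 →ₗ[ℂ] M2} (h : (choi Φ).PosSemidef) :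
    IsCompletelyPositive Φ := by
  obtain ⟨B, hB⟩ := CStarAlgebra.nonneg_iff_eq_star_mul_self.mp h.nonneg
  have key : Φ = ∑ m, conjBy (Matrix.of fun a i => star (B m (i, a))) := by
    rw [← ofChoi_choi Φ, hB]
    refine LinearMap.ext fun X => ?_
    ext a b
    simp [ofChoi_apply, conjBy_apply, Matrix.mul_apply, Fintype.sum_prod_type]
    ring
  rw [key]
  exact .sum _ _ fun _ _ => isCompletelyPositive_conjBy _

lemma IsCompletelyPositive.posSemidef {Φ : M2 →ₗ[ℂ] M2} (h : IsCompletelyPositive Φ) {X : M2}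
    (hX : X.PosSemidef) : (Φ X).PosSemidef := by
  have h1 := h 1 (Matrix.of fun _ _ => X) (by exact hX.submatrix Prod.snd)
  exact h1.submatrix (fun a => ((0 : Fin 1), a))

/-! ### Composition of channels and unitary equivalence -/

lemma one_mem_channels : (1 : Module.End ℂ M2) ∈ channels := ⟨.one, fun _ => rfl⟩

lemma mul_mem_channels {Φ Ψ : Module.End ℂ M2} (hΦ : Φ ∈ channels) (hΨ : Ψ ∈ channels) :
    Φ * Ψ ∈ channels :=
  ⟨hΦ.1.mul hΨ.1, fun X => by rw [Module.End.mul_apply, hΦ.2, hΨ.2]⟩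

lemma prod_mem_channels {l : List (Module.End ℂ M2)} (h : ∀ Ψ ∈ l, Ψ ∈ channels) :
    l.prod ∈ channels := by
  induction l with
  | nil => exact one_mem_channels
  | cons A l ih =>
    rw [List.prod_cons]
    exact mul_mem_channels (h A (by simp)) (ih fun Ψ hΨ => h Ψ (by simp [hΨ]))

lemma map_mem_densityMatrices {Φ : M2 →ₗ[ℂ] M2} (hΦ : Φ ∈ channels) {ρ : M2}
    (hρ : ρ ∈ densityMatrices) : Φ ρ ∈ densityMatrices :=
  ⟨hΦ.1.posSemidef hρ.1, by rw [hΦ.2, hρ.2]⟩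

lemma conjBy_mul (U V : M2) : (conjBy (U * V) : Module.End ℂ M2) = conjBy U * conjBy V := by
  refine LinearMap.ext fun X => ?_
  simp [conjBy, Matrix.mul_assoc]

lemma conjBy_one : (conjBy 1 : Module.End ℂ M2) = 1 := by
  refine LinearMap.ext fun X => ?_
  simp [conjBy]

lemma conjBy_mem_channels {U : M2} (hU : U ∈ unitaryGroup (Fin 2) ℂ) : conjBy U ∈ channels := by
  refine ⟨isCompletelyPositive_conjBy U, fun X => ?_⟩
  have : star U * U = 1 := (Matrix.mem_unitaryGroup_iff').mp hU
  rw [Matrix.star_eq_conjTranspose] at this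
  simp only [conjBy, LinearMap.coe_mk, AddHom.coe_mk]
  rw [Matrix.trace_mul_comm, ← Matrix.mul_assoc, this, Matrix.one_mul]

lemma unitaryChannels_subset_channels : unitaryChannels ⊆ channels := by
  rintro _ ⟨U, hU, rfl⟩
  exact conjBy_mem_channels hU

lemma one_mem_unitaryChannels : (1 : Module.End ℂ M2) ∈ unitaryChannels :=
  ⟨1, one_mem _, conjBy_one.symm⟩

lemma mul_mem_unitaryChannels {Φ Ψ : Module.End ℂ M2} (hΦ : Φ ∈ unitaryChannels)
    (hΨ : Ψ ∈ unitaryChannels) : Φ * Ψ ∈ unitaryChannels := by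
  obtain ⟨U, hU, rfl⟩ := hΦ
  obtain ⟨V, hV, rfl⟩ := hΨ
  exact ⟨U * V, mul_mem hU hV, (conjBy_mul U V).symm⟩

lemma exists_inverse {Φ : Module.End ℂ M2} (hΦ : Φ ∈ unitaryChannels) :
    ∃ Ψ : Module.End ℂ M2, Ψ ∈ unitaryChannels ∧ Φ * Ψ = 1 ∧ Ψ * Φ = 1 := by
  obtain ⟨U, hU, rfl⟩ := hΦ
  refine ⟨conjBy (star U), ⟨star U, Unitary.star_mem hU, rfl⟩, ?_, ?_⟩
  · rw [← conjBy_mul, Matrix.mem_unitaryGroup_iff.mp hU, conjBy_one]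
  · rw [← conjBy_mul, Matrix.mem_unitaryGroup_iff'.mp hU, conjBy_one]

lemma unitarilyEquivalent_iff {Φ Ψ : Module.End ℂ M2} : UnitarilyEquivalent Φ Ψ ↔
    ∃ U V : Module.End ℂ M2, U ∈ unitaryChannels ∧ V ∈ unitaryChannels ∧ Φ = U * Ψ * V := by
  constructor
  · rintro ⟨U, hU, V, hV, h⟩
    exact ⟨U, V, hU, hV, by rw [h, mul_assoc]; rfl⟩
  · rintro ⟨U, V, hU, hV, h⟩
    exact ⟨U, hU, V, hV, by rw [h, mul_assoc]; rfl⟩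

lemma UnitarilyEquivalent.refl (Φ : Module.End ℂ M2) : UnitarilyEquivalent Φ Φ :=
  unitarilyEquivalent_iff.mpr ⟨1, 1, one_mem_unitaryChannels, one_mem_unitaryChannels, by simp⟩

lemma UnitarilyEquivalent.symm {Φ Ψ : Module.End ℂ M2} (h : UnitarilyEquivalent Φ Ψ) :
    UnitarilyEquivalent Ψ Φ := by
  obtain ⟨U, V, hU, hV, h⟩ := unitarilyEquivalent_iff.mp h
  obtain ⟨U', hU', -, h1⟩ := exists_inverse hU
  obtain ⟨V', hV', h2, -⟩ := exists_inverse hV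
  refine unitarilyEquivalent_iff.mpr ⟨U', V', hU', hV', ?_⟩
  rw [h]
  calc Ψ = (U' * U) * Ψ * (V * V') := by simp [h1, h2]
    _ = U' * (U * Ψ * V) * V' := by simp only [mul_assoc]

lemma UnitarilyEquivalent.trans {Φ Ψ Ξ : Module.End ℂ M2} (h : UnitarilyEquivalent Φ Ψ)
    (h' : UnitarilyEquivalent Ψ Ξ) : UnitarilyEquivalent Φ Ξ := by
  obtain ⟨U, V, hU, hV, rfl⟩ := unitarilyEquivalent_iff.mp h
  obtain ⟨U', V', hU', hV', rfl⟩ := unitarilyEquivalent_iff.mp h'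
  exact unitarilyEquivalent_iff.mpr ⟨U * U', V' * V, mul_mem_unitaryChannels hU hU',
    mul_mem_unitaryChannels hV' hV, by simp only [mul_assoc]⟩

/-! ### Bloch vectors, density matrices and pure states -/

/-- The Hermitian matrix of trace one with the given Bloch vector. -/
noncomputable def bloch (x y z : ℝ) : M2 :=
  !![(1 + z) / 2, (x - y * Complex.I) / 2; (x + y * Complex.I) / 2, (1 - z) / 2]

lemma exists_bloch {X : M2} (h : X.IsHermitian) (ht : X.trace = 1) :
    ∃ x y z : ℝ, X = bloch x y z := by
  have h00 : star (X 0 0) = X 0 0 := h.apply 0 0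
  have h01 : star (X 0 1) = X 1 0 := h.apply 1 0
  have h11 : X 1 1 = 1 - X 0 0 := by
    rw [← ht, Matrix.trace_fin_two]; ring
  have him : (X 0 0).im = 0 := Complex.conj_eq_iff_im.mp h00
  refine ⟨2 * (X 0 1).re, -2 * (X 0 1).im, 2 * (X 0 0).re - 1, ?_⟩
  ext i j
  fin_cases i <;> fin_cases j <;>
    simp [bloch, h11, ← h01, Complex.ext_iff, him]
  all_goals ring

lemma bloch_injective {x y z x' y' z' : ℝ} (h : bloch x y z = bloch x' y' z') :
    x = x' ∧ y = y' ∧ z = z' := by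
  have h0 := congr_fun₂ h 0 0
  have h1 := congr_fun₂ h 0 1
  simp [bloch, Complex.ext_iff] at h0 h1
  exact ⟨h1.1, h1.2, h0⟩

lemma trace_bloch (x y z : ℝ) : (bloch x y z).trace = 1 := by
  simp [bloch, Matrix.trace_fin_two]; ring

lemma det_bloch (x y z : ℝ) : (bloch x y z).det = ((1 - (x ^ 2 + y ^ 2 + z ^ 2)) / 4 : ℝ) := by
  simp [bloch, Matrix.det_fin_two]
  ring_nf
  simp only [Complex.I_sq]
  ring

/-- Completing the square: `p` times the quadratic form is |p v₀ + w v₁|² + (pq − |w|²)|v₁|². For `p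
= 0` the product `w v₁` vanishes. -/
lemma posSemidef_fin_two {p q : ℝ} {w : ℂ} (hp : 0 ≤ p) (hq : 0 ≤ q)
    (hw : w.re ^ 2 + w.im ^ 2 ≤ p * q) :
    (!![(p : ℂ), w; star w, (q : ℂ)] : M2).PosSemidef := by
  refine .of_dotProduct_mulVec_nonneg ?_ fun v => ?_
  · ext i j
    fin_cases i <;> fin_cases j <;> simp
  · have key : star v ⬝ᵥ (!![(p : ℂ), w; star w, (q : ℂ)] *ᵥ v)
        = ((p * ((v 0).re ^ 2 + (v 0).im ^ 2) + q * ((v 1).re ^ 2 + (v 1).im ^ 2)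
          + 2 * ((w * v 1).re * (v 0).re + (w * v 1).im * (v 0).im) : ℝ) : ℂ) := by
      refine Complex.ext ?_ ?_
      · simp [dotProduct, Fin.sum_univ_two, Matrix.mulVec, -Complex.ofReal_pow]
        ring
      · simp [dotProduct, Fin.sum_univ_two, Matrix.mulVec, -Complex.ofReal_pow]
        ring
    rw [key]
    norm_cast
    have hs : (w * v 1).re ^ 2 + (w * v 1).im ^ 2
        ≤ (p * q) * ((v 1).re ^ 2 + (v 1).im ^ 2) := by
      have := mul_le_mul_of_nonneg_right hw (by positivity : 0 ≤ (v 1).re ^ 2 + (v 1).im ^ 2)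
      simp only [Complex.mul_re, Complex.mul_im]
      linarith
    set c := (w * v 1).re
    set d := (w * v 1).im
    rcases hp.eq_or_lt with rfl | hp
    · have hc : c = 0 := by nlinarith [sq_nonneg c, sq_nonneg d]
      have hd : d = 0 := by nlinarith [sq_nonneg c, sq_nonneg d]
      rw [hc, hd]
      have : 0 ≤ q * ((v 1).re ^ 2 + (v 1).im ^ 2) := by positivity
      linarith
    · refine nonneg_of_mul_nonneg_right ?_ hp
      nlinarith [sq_nonneg (p * (v 0).re + c), sq_nonneg (p * (v 0).im + d)]

lemma bloch_mem_densityMatrices_iff {x y z : ℝ} :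
    bloch x y z ∈ densityMatrices ↔ x ^ 2 + y ^ 2 + z ^ 2 ≤ 1 := by
  constructor
  · intro h
    have := h.1.det_nonneg
    rw [det_bloch] at this
    norm_cast at this
    linarith
  · intro h
    refine ⟨?_, trace_bloch x y z⟩
    have h1 : z ^ 2 ≤ 1 := by nlinarith [sq_nonneg x, sq_nonneg y]
    have h2 := abs_le_one_iff_mul_self_le_one.mpr (by nlinarith : z * z ≤ 1)
    obtain ⟨h3, h4⟩ := abs_le.mp h2
    have := posSemidef_fin_two (p := (1 + z) / 2) (q := (1 - z) / 2) (w := ⟨x / 2, -y / 2⟩)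
      (by linarith) (by linarith) (by simp only; nlinarith)
    convert this using 1
    ext i j
    fin_cases i <;> fin_cases j <;> simp [bloch, Complex.ext_iff]
    all_goals ring

lemma mem_densityMatrices_iff {ρ : M2} :
    ρ ∈ densityMatrices ↔ ∃ x y z : ℝ, x ^ 2 + y ^ 2 + z ^ 2 ≤ 1 ∧ ρ = bloch x y z := by
  constructor
  · intro h
    obtain ⟨x, y, z, rfl⟩ := exists_bloch h.1.1 h.2
    exact ⟨x, y, z, bloch_mem_densityMatrices_iff.mp h, rfl⟩
  · rintro ⟨x, y, z, h, rfl⟩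
    exact bloch_mem_densityMatrices_iff.mpr h

lemma mem_pureStates_iff_det {ρ : M2} : ρ ∈ pureStates ↔ ρ ∈ densityMatrices ∧ ρ.det = 0 := by
  refine and_congr_right fun h => ⟨fun h1 => ?_, fun h1 => ?_⟩
  · by_contra hne
    have := Matrix.rank_of_isUnit ρ ((Matrix.isUnit_iff_isUnit_det ρ).mpr (isUnit_iff_ne_zero.mpr hne))
    rw [h1] at this
    simp at this
  · have hle : ρ.rank ≤ 2 := by simpa using ρ.rank_le_width
    have h0 : ρ.rank ≠ 0 := by
      intro h0
      rw [Matrix.rank, Submodule.finrank_eq_zero, LinearMap.range_eq_bot, ← Matrix.toLin'_apply', LinearEquiv.map_eq_zero_iff] at h0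
      have := h.2
      rw [h0] at this
      simp at this
    have h2 : ρ.rank ≠ 2 := by
      intro h2
      obtain ⟨v, hv, hv0⟩ := Matrix.exists_mulVec_eq_zero_iff.mpr h1
      have hr := LinearMap.finrank_range_add_finrank_ker ρ.mulVecLin
      have hk : 0 < Module.finrank ℂ (LinearMap.ker ρ.mulVecLin) := by
        rw [Module.finrank_pos_iff]
        exact ⟨⟨⟨v, hv0⟩, 0, fun he => hv (congr_arg Subtype.val he)⟩⟩
      rw [Matrix.rank] at h2
      simp at hr
      omega
    omega

lemma bloch_mem_pureStates_iff {x y z : ℝ} :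
    bloch x y z ∈ pureStates ↔ x ^ 2 + y ^ 2 + z ^ 2 = 1 := by
  rw [mem_pureStates_iff_det, bloch_mem_densityMatrices_iff, det_bloch]
  norm_cast
  constructor
  · rintro ⟨-, h⟩; linarith
  · intro h; constructor <;> linarith

lemma mem_pureStates_iff {ρ : M2} :
    ρ ∈ pureStates ↔ ∃ x y z : ℝ, x ^ 2 + y ^ 2 + z ^ 2 = 1 ∧ ρ = bloch x y z := by
  constructor
  · intro h
    obtain ⟨x, y, z, -, rfl⟩ := mem_densityMatrices_iff.mp h.1
    exact ⟨x, y, z, bloch_mem_pureStates_iff.mp h, rfl⟩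
  · rintro ⟨x, y, z, h, rfl⟩
    exact bloch_mem_pureStates_iff.mpr h

/-- Two linear maps that agree on pure states are equal. -/
lemma ext_pureStates {Φ Ψ : M2 →ₗ[ℂ] M2} (h : ∀ ρ ∈ pureStates, Φ ρ = Ψ ρ) : Φ = Ψ := by
  have hx := h (bloch 1 0 0) (bloch_mem_pureStates_iff.mpr (by norm_num))
  have hy := h (bloch 0 1 0) (bloch_mem_pureStates_iff.mpr (by norm_num))
  have hz := h (bloch 0 0 1) (bloch_mem_pureStates_iff.mpr (by norm_num))
  have hz' := h (bloch 0 0 (-1)) (bloch_mem_pureStates_iff.mpr (by norm_num))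
  -- These four pure states span the matrices; the coefficients are the coordinates of `X`.
  have key : ∀ X : M2, X = (X 0 1 + X 1 0) • bloch 1 0 0
      + ((X 0 1 - X 1 0) * Complex.I) • bloch 0 1 0
      + (X 0 0 - (X 0 1 + X 1 0) / 2 - (X 0 1 - X 1 0) * Complex.I / 2) • bloch 0 0 1
      + (X 1 1 - (X 0 1 + X 1 0) / 2 - (X 0 1 - X 1 0) * Complex.I / 2) • bloch 0 0 (-1) := by
    intro X
    ext i j
    fin_cases i <;> fin_cases j <;> simp [bloch] <;> ring_nf <;> simp <;> ring
  refine LinearMap.ext fun X => ?_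
  rw [key X]
  simp only [map_add, map_smul, hx, hy, hz, hz']

/-- A pure state dominates a positive multiple of no other state. -/
lemma eq_of_posSemidef_sub {σ τ : M2} (hσ : σ ∈ pureStates) (hτ : τ ∈ densityMatrices) {a : ℝ}
    (ha : 0 < a) (h : (σ - (a : ℂ) • τ).PosSemidef) : τ = σ := by
  -- At a kernel vector `v` of σ the form of σ − aτ equals −a⟨v, τv⟩, so τ kills `v` as well. Then σ
  -- − τ is singular, while its determinant is −1/4 times the squared distance of the Bloch vectors.
  obtain ⟨v, hv, hv0⟩ := Matrix.exists_mulVec_eq_zero_iff.mpr (mem_pureStates_iff_det.mp hσ).2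
  have h1 := h.dotProduct_mulVec_nonneg v
  rw [Matrix.sub_mulVec, hv0, Matrix.smul_mulVec, zero_sub, dotProduct_neg, dotProduct_smul,
    smul_eq_mul] at h1
  have h2 := hτ.1.dotProduct_mulVec_nonneg v
  have h3 : star v ⬝ᵥ (τ *ᵥ v) = 0 := by
    have ha' : (0 : ℂ) < a := by exact_mod_cast ha
    refine le_antisymm ?_ h2
    have h4 : (a : ℂ) * (star v ⬝ᵥ (τ *ᵥ v)) ≤ 0 := by
      simpa using h1
    by_contra hn
    exact absurd (mul_pos ha' (lt_of_le_of_ne h2 fun he => hn he.symm.le)) h4.not_gt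
  have h4 := (hτ.1.dotProduct_mulVec_zero_iff v).mp h3
  obtain ⟨x, y, z, -, rfl⟩ := mem_densityMatrices_iff.mp hσ.1
  obtain ⟨x', y', z', -, rfl⟩ := mem_densityMatrices_iff.mp hτ
  have h5 : (bloch x y z - bloch x' y' z') *ᵥ v = 0 := by
    rw [Matrix.sub_mulVec, hv0, h4, sub_zero]
  have h6 := Matrix.exists_mulVec_eq_zero_iff.mp ⟨v, hv, h5⟩
  have h7 : ((bloch x y z - bloch x' y' z') : M2).det
      = ((-((x - x') ^ 2 + (y - y') ^ 2 + (z - z') ^ 2) / 4 : ℝ) : ℂ) := by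
    simp [bloch, Matrix.det_fin_two]
    ring_nf
    simp only [Complex.I_sq]
    ring
  rw [h7] at h6
  norm_cast at h6
  have hx : x - x' = 0 := by nlinarith [sq_nonneg (x - x'), sq_nonneg (y - y'), sq_nonneg (z - z')]
  have hy : y - y' = 0 := by nlinarith [sq_nonneg (x - x'), sq_nonneg (y - y'), sq_nonneg (z - z')]
  have hz : z - z' = 0 := by nlinarith [sq_nonneg (x - x'), sq_nonneg (y - y'), sq_nonneg (z - z')]
  rw [sub_eq_zero.mp hx, sub_eq_zero.mp hy, sub_eq_zero.mp hz]

lemma eq_of_convex_combination {σ τ τ' : M2} (hσ : σ ∈ pureStates) (hτ : τ ∈ densityMatrices)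
    (hτ' : τ' ∈ densityMatrices) {a b : ℝ} (ha : 0 < a) (hb : 0 < b)
    (h : σ = (a : ℂ) • τ + (b : ℂ) • τ') : τ = σ ∧ τ' = σ := by
  constructor
  · refine eq_of_posSemidef_sub hσ hτ ha ?_
    rw [h, add_sub_cancel_left]
    exact hτ'.1.smul (by exact_mod_cast hb.le)
  · refine eq_of_posSemidef_sub hσ hτ' hb ?_
    rw [h, add_sub_cancel_right]
    exact hτ.1.smul (by exact_mod_cast ha.le)

lemma constantChannel_apply (ρ X : M2) : constantChannel ρ X = X.trace • ρ := rfl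

/-- A channel that maps a mixed state to a pure state is constant. -/
lemma eq_constantChannel {A : M2 →ₗ[ℂ] M2} (hA : A ∈ channels) {ρ : M2}
    (hρ : ρ ∈ densityMatrices) (hmix : ρ ∉ pureStates) (hpure : A ρ ∈ pureStates) :
    A = constantChannel (A ρ) := by
  refine ext_pureStates fun τ hτ => ?_
  rw [constantChannel_apply, hτ.1.2, one_smul]
  obtain ⟨x, y, z, hr, rfl⟩ := mem_densityMatrices_iff.mp hρ
  obtain ⟨x', y', z', hr', rfl⟩ := mem_densityMatrices_iff.mp hτ.1
  rw [bloch_mem_pureStates_iff] at hmix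
  have hc : 0 < (1 - (x ^ 2 + y ^ 2 + z ^ 2)) / 4 := by
    have := lt_of_le_of_ne hr hmix
    linarith
  -- `c` is the determinant of ρ. It is small enough that ρ − cτ is positive for every pure τ: write
  -- it as (ρ − c) + c(1 − τ), where ρ − c has determinant c². Applying `A` shows that the pure
  -- state `A ρ` dominates `c • A τ`.
  set c := (1 - (x ^ 2 + y ^ 2 + z ^ 2)) / 4 with hcdef
  refine eq_of_posSemidef_sub hpure (map_mem_densityMatrices hA hτ.1) hc ?_
  rw [← map_smul, ← map_sub]
  refine hA.1.posSemidef ?_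
  have h1 := posSemidef_fin_two (p := (1 + z) / 2 - c) (q := (1 - z) / 2 - c)
    (w := ⟨x / 2, -y / 2⟩) (by nlinarith [sq_nonneg x, sq_nonneg y, sq_nonneg (1 + z)])
    (by nlinarith [sq_nonneg x, sq_nonneg y, sq_nonneg (1 - z)])
    (by simp only; nlinarith [sq_nonneg c])
  have h2 : ((c : ℂ) • bloch (-x') (-y') (-z')).PosSemidef :=
    (bloch_mem_densityMatrices_iff.mpr (by simpa using hr')).1.smul (by exact_mod_cast hc.le)
  convert h1.add h2 using 1
  ext i j
  fin_cases i <;> fin_cases j <;> simp [bloch, Complex.ext_iff] <;> (try constructor) <;> ring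

/-! ### Inner products of Bloch vectors and rotations to standard position -/

lemma conjBy_mem_pureStates {U ρ : M2} (hU : U ∈ unitaryGroup (Fin 2) ℂ) (hρ : ρ ∈ pureStates) :
    conjBy U ρ ∈ pureStates := by
  rw [mem_pureStates_iff_det] at hρ ⊢
  refine ⟨map_mem_densityMatrices (conjBy_mem_channels hU) hρ.1, ?_⟩
  rw [conjBy_apply, Matrix.det_mul, Matrix.det_mul, hρ.2]
  simp

lemma map_mem_pureStates {U : M2 →ₗ[ℂ] M2} {ρ : M2} (hU : U ∈ unitaryChannels)
    (hρ : ρ ∈ pureStates) : U ρ ∈ pureStates := by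
  obtain ⟨V, hV, rfl⟩ := hU
  exact conjBy_mem_pureStates hV hρ

/-- The inner product of the Bloch vectors of two states. -/
noncomputable def blochInner (ρ σ : M2) : ℝ := 2 * (ρ * σ).trace.re - 1

lemma blochInner_bloch (x y z x' y' z' : ℝ) :
    blochInner (bloch x y z) (bloch x' y' z') = x * x' + y * y' + z * z' := by
  simp [blochInner, bloch, Matrix.trace_fin_two]
  ring

lemma blochInner_map {U : M2 →ₗ[ℂ] M2} (hU : U ∈ unitaryChannels) (ρ σ : M2) :
    blochInner (U ρ) (U σ) = blochInner ρ σ := by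
  obtain ⟨V, hV, rfl⟩ := hU
  have h : Vᴴ * V = 1 := by
    rw [← Matrix.star_eq_conjTranspose]; exact (Matrix.mem_unitaryGroup_iff').mp hV
  have : conjBy V ρ * conjBy V σ = V * (ρ * σ) * Vᴴ := by
    simp only [conjBy_apply]
    calc V * ρ * Vᴴ * (V * σ * Vᴴ) = V * ρ * (Vᴴ * V) * σ * Vᴴ := by simp only [Matrix.mul_assoc]
      _ = _ := by rw [h]; simp only [Matrix.mul_assoc, Matrix.one_mul]
  rw [blochInner, this, Matrix.trace_mul_comm, ← Matrix.mul_assoc, h, Matrix.one_mul, blochInner]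

lemma blochInner_self {ρ : M2} (hρ : ρ ∈ pureStates) : blochInner ρ ρ = 1 := by
  obtain ⟨x, y, z, h, rfl⟩ := mem_pureStates_iff.mp hρ
  rw [blochInner_bloch]; linarith

lemma blochInner_bounds {ρ σ : M2} (hρ : ρ ∈ pureStates) (hσ : σ ∈ pureStates) :
    -1 ≤ blochInner ρ σ ∧ blochInner ρ σ ≤ 1 := by
  obtain ⟨x, y, z, h, rfl⟩ := mem_pureStates_iff.mp hρ
  obtain ⟨x', y', z', h', rfl⟩ := mem_pureStates_iff.mp hσ
  rw [blochInner_bloch]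
  constructor
  · nlinarith [sq_nonneg (x + x'), sq_nonneg (y + y'), sq_nonneg (z + z')]
  · nlinarith [sq_nonneg (x - x'), sq_nonneg (y - y'), sq_nonneg (z - z')]

lemma blochInner_lt_one {ρ σ : M2} (hρ : ρ ∈ pureStates) (hσ : σ ∈ pureStates) (hne : ρ ≠ σ) :
    blochInner ρ σ < 1 := by
  refine lt_of_le_of_ne (blochInner_bounds hρ hσ).2 fun h1 => hne ?_
  obtain ⟨x, y, z, h, rfl⟩ := mem_pureStates_iff.mp hρ
  obtain ⟨x', y', z', h', rfl⟩ := mem_pureStates_iff.mp hσ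
  rw [blochInner_bloch] at h1
  have hx : x - x' = 0 := by nlinarith [sq_nonneg (x - x'), sq_nonneg (y - y'), sq_nonneg (z - z')]
  have hy : y - y' = 0 := by nlinarith [sq_nonneg (x - x'), sq_nonneg (y - y'), sq_nonneg (z - z')]
  have hz : z - z' = 0 := by nlinarith [sq_nonneg (x - x'), sq_nonneg (y - y'), sq_nonneg (z - z')]
  rw [sub_eq_zero.mp hx, sub_eq_zero.mp hy, sub_eq_zero.mp hz]

/-- Every pure state can be rotated to the north pole. -/
lemma exists_unitary_pole {ρ : M2} (hρ : ρ ∈ pureStates) :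
    ∃ U : Module.End ℂ M2, U ∈ unitaryChannels ∧ U ρ = bloch 0 0 1 := by
  obtain ⟨x, y, z, h, rfl⟩ := mem_pureStates_iff.mp hρ
  -- (c, w) is a unit vector spanning the range of the state, with its phase chosen so that the
  -- first entry is real. The unitary below sends it to the first basis vector.
  suffices ∃ (c : ℝ) (w : ℂ), c ^ 2 + w * star w = 1 ∧
      bloch x y z = !![(c : ℂ) ^ 2, c * star w; c * w, w * star w] by
    obtain ⟨c, w, h1, h2⟩ := this
    have hU : !![(c : ℂ), star w; -w, c] ∈ unitaryGroup (Fin 2) ℂ := by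
      rw [Matrix.mem_unitaryGroup_iff]
      ext i j
      fin_cases i <;> fin_cases j <;>
        simp [Matrix.mul_apply, Fin.sum_univ_two] <;>
        simp at h1 <;> first | ring1 | linear_combination h1
    refine ⟨_, ⟨_, hU, rfl⟩, ?_⟩
    rw [h2, conjBy_apply]
    simp only [RCLike.star_def] at h1
    ext i j
    fin_cases i <;> fin_cases j <;>
      simp [Matrix.mul_apply, Fin.sum_univ_two, bloch]
    · linear_combination ((c:ℂ) ^ 2 + w * (starRingEnd ℂ) w + 1) * h1
    · ring
    · ring
    · ring
  rcases eq_or_ne z (-1) with rfl | hz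
  · have hx : x = 0 := by nlinarith [sq_nonneg x, sq_nonneg y]
    have hy : y = 0 := by nlinarith [sq_nonneg x, sq_nonneg y]
    subst hx hy
    refine ⟨0, 1, by simp, ?_⟩
    ext i j
    fin_cases i <;> fin_cases j <;> simp [bloch]
  · have hz1 : 0 < (1 + z) / 2 := by
      have : -1 ≤ z := by nlinarith [sq_nonneg x, sq_nonneg y]
      have := lt_of_le_of_ne this (Ne.symm hz)
      linarith
    have hc := Real.sqrt_pos.mpr hz1
    have hc2 := Real.sq_sqrt hz1.le
    set c := √((1 + z) / 2)
    have hcC : (c : ℂ) ≠ 0 := by exact_mod_cast hc.ne'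
    have hc2C : (c : ℂ) ^ 2 = (1 + z) / 2 := by exact_mod_cast hc2
    have hC : (x : ℂ) ^ 2 + y ^ 2 + z ^ 2 = 1 := by exact_mod_cast h
    have hw : ((x + y * Complex.I) / (2 * c) : ℂ) * star ((x + y * Complex.I) / (2 * c) : ℂ)
        = (1 - z) / 2 := by
      simp
      field_simp
      ring_nf
      simp only [Complex.I_sq]
      linear_combination hC - 2 * (1 - z) * hc2C
    refine ⟨c, (x + y * Complex.I) / (2 * c), ?_, ?_⟩
    · rw [hw, hc2C]; ring
    · rw [hw, hc2C]
      ext i j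
      fin_cases i <;> fin_cases j <;> simp [bloch] <;> field_simp <;> ring

/-- Every pair of pure states can be rotated to the north pole and a standard pure state. -/
lemma exists_unitary_pair {ρ σ : M2} (hρ : ρ ∈ pureStates) (hσ : σ ∈ pureStates) :
    ∃ U : Module.End ℂ M2, U ∈ unitaryChannels ∧ U ρ = bloch 0 0 1 ∧
      U σ = bloch (√(1 - blochInner ρ σ ^ 2)) 0 (blochInner ρ σ) := by
  obtain ⟨U, hU, hUρ⟩ := exists_unitary_pole hρ
  have hp := map_mem_pureStates hU hσ
  obtain ⟨x, y, z, h, hσ'⟩ := mem_pureStates_iff.mp hp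
  have hin : blochInner ρ σ = z := by
    rw [← blochInner_map hU, hUρ, hσ', blochInner_bloch]; ring
  -- After the first rotation only the azimuth is left to fix. Conjugation by diag(1, u), with u the
  -- phase of `w`, fixes the pole and turns the second state into the half-plane y = 0, x ≥ 0.
  set w : ℂ := ⟨x, -y⟩ with hw
  have hnorm : ‖w‖ = √(1 - z ^ 2) := by
    rw [Complex.norm_def, Complex.normSq_apply]
    congr 1
    simp only [hw]; linarith
  have hu := Complex.norm_mul_exp_arg_mul_I w
  have hu1 := Complex.norm_exp_ofReal_mul_I w.arg
  set u := Complex.exp (w.arg * Complex.I)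
  have huu : u * star u = 1 := by
    rw [RCLike.star_def, Complex.mul_conj, Complex.normSq_eq_norm_sq, hu1]; simp
  have hD : !![1, 0; 0, u] ∈ unitaryGroup (Fin 2) ℂ := by
    rw [Matrix.mem_unitaryGroup_iff]
    simp only [RCLike.star_def] at huu
    ext i j
    fin_cases i <;> fin_cases j <;> simp [Matrix.mul_apply, Fin.sum_univ_two, huu]
  have hD1 : conjBy !![1, 0; 0, u] ∈ unitaryChannels := ⟨_, hD, rfl⟩
  refine ⟨conjBy !![1, 0; 0, u] * U, mul_mem_unitaryChannels hD1 hU, ?_, ?_⟩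
  · rw [Module.End.mul_apply, hUρ, conjBy_apply]
    ext i j
    fin_cases i <;> fin_cases j <;> simp [Matrix.mul_apply, Fin.sum_univ_two, bloch]
  · rw [Module.End.mul_apply, hσ', hin, conjBy_apply, ← hnorm]
    have e1 : (x - y * Complex.I : ℂ) = ‖w‖ * u := by rw [hu]; simp [hw, Complex.ext_iff]
    have e2 : (x + y * Complex.I : ℂ) = ‖w‖ * star u := by
      have := congr_arg star e1
      simpa using this
    simp only [RCLike.star_def] at huu e2
    ext i j
    fin_cases i <;> fin_cases j <;> simp [Matrix.mul_apply, Fin.sum_univ_two, bloch, e1, e2]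
    · linear_combination (‖w‖ : ℂ) / 2 * huu
    · linear_combination (‖w‖ : ℂ) / 2 * huu
    · linear_combination (1 - (z : ℂ)) / 2 * huu

/-! ### Channels that fix the north pole -/

/-- The Hermiticity and trace preserving maps that fix the north pole and whose Choi matrix is
supported away from the corresponding null vector. -/
noncomputable def poleMap (b y : ℂ) (s : ℝ) : M2 →ₗ[ℂ] M2 where
  toFun X := !![X 0 0 + (1 - s) * X 1 1, b * X 0 1 + y * X 1 1;
    star b * X 1 0 + star y * X 1 1, s * X 1 1]
  map_add' X Y := by
    ext i j
    fin_cases i <;> fin_cases j <;> simp <;> ring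
  map_smul' c X := by
    ext i j
    fin_cases i <;> fin_cases j <;> simp <;> ring

lemma poleMap_apply (b y : ℂ) (s : ℝ) (X : M2) :
    poleMap b y s X = !![X 0 0 + (1 - s) * X 1 1, b * X 0 1 + y * X 1 1;
      star b * X 1 0 + star y * X 1 1, s * X 1 1] := rfl

lemma poleMap_pole (b y : ℂ) (s : ℝ) : poleMap b y s (bloch 0 0 1) = bloch 0 0 1 := by
  rw [poleMap_apply]
  ext i j
  fin_cases i <;> fin_cases j <;> simp [bloch]

lemma bloch_pole : bloch 0 0 1 = single 0 0 1 := by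
  ext i j
  fin_cases i <;> fin_cases j <;> simp [bloch]

lemma poleMap_injective {b y b' y' : ℂ} {s s' : ℝ} (h : poleMap b y s = poleMap b' y' s') :
    b = b' ∧ y = y' ∧ s = s' := by
  have h1 := congr_fun₂ (LinearMap.congr_fun h (single 0 1 1)) 0 1
  have h2 := congr_fun₂ (LinearMap.congr_fun h (single 1 1 1)) 0 1
  have h3 := congr_fun₂ (LinearMap.congr_fun h (single 1 1 1)) 1 1
  simp [poleMap_apply] at h1 h2 h3
  exact ⟨h1, h2, h3⟩

lemma poleMap_mul (b y b' y' : ℂ) (s s' : ℝ) :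
    (poleMap b y s * poleMap b' y' s' : Module.End ℂ M2)
      = poleMap (b * b') (b * y' + y * s') (s * s') := by
  refine LinearMap.ext fun X => ?_
  rw [Module.End.mul_apply]
  simp only [poleMap_apply]
  ext i j
  fin_cases i <;> fin_cases j <;> simp <;> ring

/-- The conditions under which `poleMap b y s` is a channel. -/
structure PoleCond (b y : ℂ) (s : ℝ) : Prop where
  le_one : s ≤ 1
  normSq_le : Complex.normSq b ≤ s
  normSq_le_mul : Complex.normSq y ≤ (1 - s) * (s - Complex.normSq b)

/-- Three Kraus operators, as in a Cholesky factorisation of the Choi matrix; the last radicand is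
the Schur complement. At `s = 1` the constraint forces `y = 0`, so the value 0 of division by zero
is the right one. -/
lemma poleMap_mem_channels {b y : ℂ} {s : ℝ} (h : PoleCond b y s) :
    poleMap b y s ∈ channels := by
  refine ⟨?_, fun X => ?_⟩
  · have h1 : 0 ≤ 1 - s := by linarith [h.le_one]
    have hy : s = 1 → y = 0 := fun hs => by
      have := h.normSq_le_mul
      rw [hs] at this
      exact Complex.normSq_eq_zero.mp (le_antisymm (by simpa using this) (Complex.normSq_nonneg y))
    have h2 : 0 ≤ s - Complex.normSq b - Complex.normSq y / (1 - s) := by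
      rcases h1.eq_or_lt with h0 | h0
      · rw [← h0, div_zero]; linarith [h.normSq_le]
      · have := (div_le_iff₀' h0).mpr h.normSq_le_mul
        linarith
    have e1 : ((√(1 - s) : ℝ) : ℂ) * (√(1 - s) : ℝ) = 1 - s := by
      exact_mod_cast congr_arg Complex.ofReal (Real.mul_self_sqrt h1)
    have e2 : ((√(s - Complex.normSq b - Complex.normSq y / (1 - s)) : ℝ) : ℂ)
        * (√(s - Complex.normSq b - Complex.normSq y / (1 - s)) : ℝ)
        = s - b * star b - y * star y / (1 - s) := by
      have := congr_arg Complex.ofReal (Real.mul_self_sqrt h2)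
      push_cast at this
      rw [this]
      simp [Complex.mul_conj]
    have e3 : y / (√(1 - s) : ℝ) * (√(1 - s) : ℝ) = y := by
      rcases eq_or_ne s 1 with hs | hs
      · simp [hy hs]
      · have : (√(1 - s) : ℝ) ≠ 0 :=
          (Real.sqrt_pos.mpr (lt_of_le_of_ne h1 (fun h => hs (by linarith)))).ne'
        rw [div_mul_cancel₀]
        exact_mod_cast this
    set r := √(1 - s)
    set t := √(s - Complex.normSq b - Complex.normSq y / (1 - s))
    have key : poleMap b y s = conjBy !![1, 0; 0, star b] + conjBy !![0, r; 0, star y / r]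
        + conjBy !![0, 0; 0, t] := by
      refine LinearMap.ext fun X => ?_
      simp only [LinearMap.add_apply, conjBy_apply, poleMap_apply]
      have e3' : star y / (r : ℂ) * r = star y := by
        have := congr_arg star e3
        simpa [mul_comm] using this
      simp only [RCLike.star_def] at e2 e3'
      ext i j
      fin_cases i <;> fin_cases j <;> simp only [Matrix.add_apply, Matrix.mul_apply,
        Fin.sum_univ_two, Matrix.conjTranspose_apply] <;> simp
      · linear_combination -(X 1 1) * e1
      · linear_combination -(X 1 1) * e3
      · linear_combination -(X 1 1) * e3'
      · have e4 : (starRingEnd ℂ) y / (r : ℂ) * X 1 1 * (y / r) = y * (starRingEnd ℂ) y / (1 - s) * X 1 1 := by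
          rw [← e1]
          ring
        rw [e4]
        linear_combination -(X 1 1) * e2
    rw [key]
    exact ((isCompletelyPositive_conjBy _).add (isCompletelyPositive_conjBy _)).add
      (isCompletelyPositive_conjBy _)
  · rw [poleMap_apply]
    simp [Matrix.trace_fin_two]
    ring

/-- Every channel that fixes the north pole is a `poleMap`. -/
lemma exists_poleMap {Φ : M2 →ₗ[ℂ] M2} (hΦ : Φ ∈ channels)
    (h : Φ (bloch 0 0 1) = bloch 0 0 1) : ∃ b y s, PoleCond b y s ∧ Φ = poleMap b y s := by
  have hC := posSemidef_choi hΦ.1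
  rw [bloch_pole] at h
  -- Fixing the pole makes one diagonal entry of the Choi matrix vanish; by positivity its whole row
  -- and column vanish.
  have hv : star (Pi.single ((0, 1) : Fin 2 × Fin 2) (1 : ℂ)) ⬝ᵥ (choi Φ *ᵥ Pi.single (0, 1) 1) = 0 := by
    simp [choi_apply, h]
  have hv0 := (hC.dotProduct_mulVec_zero_iff _).mp hv
  rw [Matrix.mulVec_single_one] at hv0
  have hcol : ∀ i a, Φ (single i 0 1) a 1 = 0 := fun i a => by
    have := congr_fun hv0 (i, a)
    simpa [choi_apply] using this
  have hherm : ∀ i j a b, star (Φ (single i j 1) a b) = Φ (single j i 1) b a := fun i j a b => by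
    have := hC.1.apply (j, b) (i, a)
    simpa [choi_apply] using this
  have htr : ∀ X, Φ X 0 0 + Φ X 1 1 = X.trace := fun X => by
    rw [← hΦ.2 X, Matrix.trace_fin_two]
  have hrow : ∀ i a, Φ (single 0 i 1) 1 a = 0 := fun i a => by
    rw [← hherm, hcol, star_zero]
  have t10 : Φ (single 1 0 1) 0 0 = 0 := by
    have := htr (single 1 0 1)
    rw [hcol, add_zero] at this
    rw [this]
    simp
  have t01 : Φ (single 0 1 1) 0 0 = 0 := by
    rw [← hherm, t10, star_zero]
  set b := Φ (single 0 1 1) 0 1 with hb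
  set y := Φ (single 1 1 1) 0 1 with hy
  have hs : Φ (single 1 1 1) 1 1 = ((Φ (single 1 1 1) 1 1).re : ℂ) :=
    (Complex.conj_eq_iff_re.mp (hherm 1 1 1 1)).symm
  set s := (Φ (single 1 1 1) 1 1).re
  have hs0 : Φ (single 1 1 1) 0 0 = 1 - s := by
    have := htr (single 1 1 1)
    rw [hs] at this
    rw [eq_sub_iff_add_eq, this]
    simp
  have hb' : Φ (single 1 0 1) 1 0 = star b := by rw [← hherm]
  have hy' : Φ (single 1 1 1) 1 0 = star y := by rw [← hherm]
  -- The three constraints are principal minors of the Choi matrix, of sizes 1, 2 and 3.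
  have hsub := hC.submatrix ![((0 : Fin 2), (0 : Fin 2)), (1, 0), (1, 1)]
  have hsub2 := hC.submatrix ![((0 : Fin 2), (0 : Fin 2)), (1, 1)]
  have hdet := hsub.det_nonneg
  have hdet2 := hsub2.det_nonneg
  have hd := hC.diag_nonneg (i := (1, 0))
  rw [choi_apply, hs0] at hd
  rw [Matrix.det_fin_two] at hdet2
  rw [Matrix.det_fin_three] at hdet
  simp [choi_apply, h, hb', hs, hs0, hy', t01, t10, ← hb, ← hy, Complex.mul_conj] at hdet hdet2
  refine ⟨b, y, s, ⟨?_, ?_, ?_⟩, ?_⟩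
  · have : ((0 : ℝ) : ℂ) ≤ ((1 - s : ℝ) : ℂ) := by simpa using hd
    have := Complex.real_le_real.mp this
    linarith
  · exact_mod_cast hdet2
  · have e' : (Complex.normSq b : ℂ) = b * star b := by simp [Complex.mul_conj]
    suffices ((0 : ℝ) : ℂ) ≤ (((1 - s) * (s - Complex.normSq b) - Complex.normSq y : ℝ) : ℂ) by
      have := Complex.real_le_real.mp this
      linarith
    rw [← sub_nonneg] at hdet
    rw [Complex.ofReal_zero]
    refine hdet.trans_eq ?_
    push_cast
    rw [e']
    simp only [RCLike.star_def]
    ring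
  · refine LinearMap.ext fun X => ?_
    rw [apply_eq_sum, poleMap_apply]
    ext i j
    fin_cases i <;> fin_cases j <;>
      simp [h, hcol, hrow, t01, t10, hb', hy', hs, hs0, ← hb, ← hy] <;> ring

/-- The conditions on `b`, `y` and `s` imposed by the image of a standard pure state. -/
lemma poleMap_standard {b y : ℂ} {s z z' : ℝ} (hc : PoleCond b y s) (hz : -1 ≤ z) (hz1 : z < 1)
    (hz' : -1 ≤ z') (hz1' : z' ≤ 1)
    (h : poleMap b y s (bloch (√(1 - z ^ 2)) 0 z) = bloch (√(1 - z' ^ 2)) 0 z') :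
    s * (1 - z) = 1 - z' ∧
    b * (√(1 - z ^ 2) : ℝ) + y * (1 - z) = (√(1 - z' ^ 2) : ℝ) ∧
    (√((1 + z) * (1 - z')) - √((1 + z') * (1 - z)) * b.re) ^ 2
      + ((1 + z') * (1 - z)) * b.im ^ 2 ≤ 0 := by
  rw [poleMap_apply] at h
  have h11 := congr_fun₂ h 1 1
  have h01 := congr_fun₂ h 0 1
  simp [bloch] at h11 h01
  have e1 : s * (1 - z) = 1 - z' := by
    have : (s * (1 - z) : ℂ) = 1 - z' := by linear_combination 2 * h11
    exact_mod_cast this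
  have e2 : b * (√(1 - z ^ 2) : ℝ) + y * (1 - z) = (√(1 - z' ^ 2) : ℝ) := by
    linear_combination 2 * h01
  refine ⟨e1, e2, ?_⟩
  have hre := congr_arg Complex.re e2
  have him := congr_arg Complex.im e2
  simp at hre him
  have c1 : 0 ≤ 1 + z := by linarith
  have c2 : 0 ≤ 1 - z := by linarith
  have c3 : 0 ≤ 1 + z' := by linarith
  have c4 : 0 ≤ 1 - z' := by linarith
  have f1 : √(1 - z ^ 2) = √(1 + z) * √(1 - z) := by rw [← Real.sqrt_mul c1]; ring_nf
  have f2 : √(1 - z' ^ 2) = √(1 + z') * √(1 - z') := by rw [← Real.sqrt_mul c3]; ring_nf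
  rw [Real.sqrt_mul c1, Real.sqrt_mul c3]
  rw [f1] at hre him
  rw [f2] at hre
  have g1 := Real.sq_sqrt c1
  have g2 := Real.sq_sqrt c2
  have g3 := Real.sq_sqrt c3
  have g4 := Real.sq_sqrt c4
  set p := √(1 + z)
  set r := √(1 - z)
  set p' := √(1 + z')
  set r' := √(1 - z')
  -- Multiply the last constraint by (1 − z)² and eliminate `y` and `s` by the two linear relations.
  -- The difference of the two sides is exactly the sum of squares of the claim.
  have hin := hc.normSq_le_mul
  rw [Complex.normSq_apply, Complex.normSq_apply] at hin
  have hin' := mul_le_mul_of_nonneg_left hin (sq_nonneg (1 - z))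
  have i1 : (1 - z) ^ 2 * (y.re * y.re + y.im * y.im)
      = (p' * r' - b.re * (p * r)) ^ 2 + (b.im * (p * r)) ^ 2 := by
    have j1 : y.re * (1 - z) = p' * r' - b.re * (p * r) := by linarith
    have j2 : y.im * (1 - z) = - (b.im * (p * r)) := by linarith
    rw [← j1]
    linear_combination (y.im * (1 - z) - b.im * (p * r)) * j2
  have i2 : (1 - z) ^ 2 * ((1 - s) * (s - (b.re * b.re + b.im * b.im)))
      = (z' - z) * ((1 - z') - (1 - z) * (b.re * b.re + b.im * b.im)) := by
    have j1 : (1 - z) * (1 - s) = z' - z := by linarith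
    have j2 : (1 - z) * s = 1 - z' := by linarith
    rw [← j1, ← j2]; ring
  rw [i1, i2] at hin'
  have k1 : z = p ^ 2 - 1 := by linarith
  have k3 : z' = p' ^ 2 - 1 := by linarith
  have k2 : r ^ 2 = 2 - p ^ 2 := by linarith
  have k4 : r' ^ 2 = 2 - p' ^ 2 := by linarith
  rw [k1, k3] at hin' ⊢
  have : (p * r' - p' * r * b.re) ^ 2 + (1 + (p' ^ 2 - 1)) * (1 - (p ^ 2 - 1)) * b.im ^ 2
      = ((p' * r' - b.re * (p * r)) ^ 2 + (b.im * (p * r)) ^ 2)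
      - (p' ^ 2 - 1 - (p ^ 2 - 1)) * ((1 - (p' ^ 2 - 1)) - (1 - (p ^ 2 - 1)) * (b.re * b.re + b.im * b.im)) := by
    have l : ∀ a c : ℝ, (a * c) ^ 2 = a ^ 2 * c ^ 2 := fun a c => by ring
    have m1 : (p * r' - p' * r * b.re) ^ 2
      = p ^ 2 * r' ^ 2 - 2 * (p * p' * r * r') * b.re + p' ^ 2 * r ^ 2 * b.re ^ 2 := by ring
    have m2 : (p' * r' - b.re * (p * r)) ^ 2
      = p' ^ 2 * r' ^ 2 - 2 * (p * p' * r * r') * b.re + p ^ 2 * r ^ 2 * b.re ^ 2 := by ring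
    rw [m1, m2, l b.im, l p, k2, k4]
    ring
  linarith

/-- By `poleMap_standard` the parameter `s` is determined, and a sum of squares that is at most zero
determines `b`, then `y` follows. The weight (1 + z')(1 − z) must be positive: for z' = −1 the
images are orthogonal and dephasing leaves `b` free. -/
lemma eq_of_standard {Φ Ψ : M2 →ₗ[ℂ] M2} (hΦ : Φ ∈ channels) (hΨ : Ψ ∈ channels) {z z' : ℝ}
    (hz : -1 ≤ z) (hz1 : z < 1) (hz' : -1 < z') (hz1' : z' ≤ 1)
    (h1 : Φ (bloch 0 0 1) = bloch 0 0 1) (h2 : Ψ (bloch 0 0 1) = bloch 0 0 1)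
    (h3 : Φ (bloch (√(1 - z ^ 2)) 0 z) = bloch (√(1 - z' ^ 2)) 0 z')
    (h4 : Ψ (bloch (√(1 - z ^ 2)) 0 z) = bloch (√(1 - z' ^ 2)) 0 z') : Φ = Ψ := by
  obtain ⟨b, y, s, hc, rfl⟩ := exists_poleMap hΦ h1
  obtain ⟨b', y', s', hc', rfl⟩ := exists_poleMap hΨ h2
  obtain ⟨a1, a2, a3⟩ := poleMap_standard hc hz hz1 hz'.le hz1' h3
  obtain ⟨a1', a2', a3'⟩ := poleMap_standard hc' hz hz1 hz'.le hz1' h4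
  have hz2 : 1 - z ≠ 0 := by linarith
  have hs : s = s' := mul_right_cancel₀ hz2 (a1.trans a1'.symm)
  have hK : 0 < (1 + z') * (1 - z) := mul_pos (by linarith) (by linarith)
  have hK' := Real.sqrt_pos.mpr hK
  have him : ∀ w : ℂ, (√((1 + z) * (1 - z')) - √((1 + z') * (1 - z)) * w.re) ^ 2
      + ((1 + z') * (1 - z)) * w.im ^ 2 ≤ 0 →
      w.im = 0 ∧ √((1 + z') * (1 - z)) * w.re = √((1 + z) * (1 - z')) := by
    intro w hw
    have e1 := sq_nonneg (√((1 + z) * (1 - z')) - √((1 + z') * (1 - z)) * w.re)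
    have e2 := mul_nonneg hK.le (sq_nonneg w.im)
    constructor
    · have : ((1 + z') * (1 - z)) * w.im ^ 2 = 0 := by linarith
      simpa [hK.ne'] using this
    · have : (√((1 + z) * (1 - z')) - √((1 + z') * (1 - z)) * w.re) ^ 2 = 0 := by linarith
      rw [sq_eq_zero_iff, sub_eq_zero] at this
      exact this.symm
  have hb : b = b' := by
    refine Complex.ext (mul_left_cancel₀ hK'.ne' ?_) ?_
    · rw [(him b a3).2, (him b' a3').2]
    · rw [(him b a3).1, (him b' a3').1]
  have hy : y = y' := by
    have hz2' : (1 - z : ℂ) ≠ 0 := by exact_mod_cast hz2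
    refine mul_right_cancel₀ hz2' ?_
    rw [hb] at a2
    linear_combination a2 - a2'
  rw [hs, hb, hy]

/-- Channels do not decrease the Bloch inner product of pure states that they map to pure states. -/
lemma blochInner_le {Φ : Module.End ℂ M2} (hΦ : Φ ∈ channels) {ρ σ : M2} (hρ : ρ ∈ pureStates)
    (hσ : σ ∈ pureStates) (hρ' : Φ ρ ∈ pureStates) (hσ' : Φ σ ∈ pureStates) :
    blochInner ρ σ ≤ blochInner (Φ ρ) (Φ σ) := by
  obtain ⟨U, hU, hU1, hU2⟩ := exists_unitary_pair hρ hσ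
  obtain ⟨V, hV, hV1, hV2⟩ := exists_unitary_pair hρ' hσ'
  obtain ⟨U', hU', -, hUU⟩ := exists_inverse hU
  have hch : V * Φ * U' ∈ channels := mul_mem_channels
    (mul_mem_channels (unitaryChannels_subset_channels hV) hΦ) (unitaryChannels_subset_channels hU')
  have hinv : ∀ X, U' (U X) = X := fun X => LinearMap.congr_fun hUU X
  have e1 : (V * Φ * U') (bloch 0 0 1) = bloch 0 0 1 := by
    rw [← hU1, Module.End.mul_apply, hinv, Module.End.mul_apply, hV1, hU1]
  have e2 : (V * Φ * U') (bloch (√(1 - blochInner ρ σ ^ 2)) 0 (blochInner ρ σ))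
      = bloch (√(1 - blochInner (Φ ρ) (Φ σ) ^ 2)) 0 (blochInner (Φ ρ) (Φ σ)) := by
    rw [← hU2, Module.End.mul_apply, hinv, Module.End.mul_apply, hV2]
  have b1 := blochInner_bounds hρ hσ
  have b2 := blochInner_bounds hρ' hσ'
  rcases eq_or_ne ρ σ with rfl | hne
  · rw [blochInner_self hρ, blochInner_self hρ']
  obtain ⟨b, y, s, hc, h⟩ := exists_poleMap hch e1
  rw [h] at e2
  have b3 := blochInner_lt_one hρ hσ hne
  obtain ⟨a1, -, -⟩ := poleMap_standard hc b1.1 b3 b2.1 b2.2 e2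
  -- Since `s` is the ratio of 1 − z' to 1 − z, the constraint `s ≤ 1` is the monotonicity.
  have := mul_le_mul_of_nonneg_right hc.le_one (by linarith : 0 ≤ 1 - blochInner ρ σ)
  linarith

/-- Channels with pairs of pure states of the same inner products are unitarily equivalent. -/
lemma unitarilyEquivalent_of_pairs {Φ Ψ : Module.End ℂ M2} (hΦ : Φ ∈ channels) (hΨ : Ψ ∈ channels)
    {ρ σ τ υ : M2} (hρ : ρ ∈ pureStates) (hσ : σ ∈ pureStates) (hρ' : Φ ρ ∈ pureStates)
    (hσ' : Φ σ ∈ pureStates) (hτ : τ ∈ pureStates) (hυ : υ ∈ pureStates) (hτ' : Ψ τ ∈ pureStates)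
    (hυ' : Ψ υ ∈ pureStates) (hne : ρ ≠ σ) (hin : blochInner ρ σ = blochInner τ υ)
    (hout : blochInner (Φ ρ) (Φ σ) = blochInner (Ψ τ) (Ψ υ))
    (hlt : -1 < blochInner (Φ ρ) (Φ σ)) : UnitarilyEquivalent Φ Ψ := by
  obtain ⟨U, hU, hU1, hU2⟩ := exists_unitary_pair hρ hσ
  obtain ⟨V, hV, hV1, hV2⟩ := exists_unitary_pair hρ' hσ'
  obtain ⟨W, hW, hW1, hW2⟩ := exists_unitary_pair hτ hυ
  obtain ⟨Z, hZ, hZ1, hZ2⟩ := exists_unitary_pair hτ' hυ'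
  obtain ⟨U', hU', -, hUU⟩ := exists_inverse hU
  obtain ⟨V', hV', -, hVV⟩ := exists_inverse hV
  obtain ⟨W', hW', -, hWW⟩ := exists_inverse hW
  have hinv : ∀ X, U' (U X) = X := fun X => LinearMap.congr_fun hUU X
  have hinv' : ∀ X, W' (W X) = X := fun X => LinearMap.congr_fun hWW X
  have e : V * Φ * U' = Z * Ψ * W' := by
    have b1 := blochInner_bounds hρ hσ
    have b2 := blochInner_bounds hρ' hσ'
    refine eq_of_standard (z := blochInner ρ σ) (z' := blochInner (Φ ρ) (Φ σ))
      (mul_mem_channels (mul_mem_channels (unitaryChannels_subset_channels hV) hΦ)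
        (unitaryChannels_subset_channels hU'))
      (mul_mem_channels (mul_mem_channels (unitaryChannels_subset_channels hZ) hΨ)
        (unitaryChannels_subset_channels hW')) b1.1 (blochInner_lt_one hρ hσ hne) hlt b2.2
      ?_ ?_ ?_ ?_
    · rw [← hU1, Module.End.mul_apply, hinv, Module.End.mul_apply, hV1, hU1]
    · rw [← hW1, Module.End.mul_apply, hinv', Module.End.mul_apply, hZ1, hW1]
    · rw [← hU2, Module.End.mul_apply, hinv, Module.End.mul_apply, hV2]
    · rw [hin, ← hW2, Module.End.mul_apply, hinv', Module.End.mul_apply, hZ2, hout]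
  refine unitarilyEquivalent_iff.mpr ⟨V' * Z, W' * U, mul_mem_unitaryChannels hV' hZ,
    mul_mem_unitaryChannels hW' hU, ?_⟩
  calc Φ = (V' * V) * Φ * (U' * U) := by simp [hVV, hUU]
    _ = V' * (V * Φ * U') * U := by simp only [mul_assoc]
    _ = V' * (Z * Ψ * W') * U := by rw [e]
    _ = V' * Z * Ψ * (W' * U) := by simp only [mul_assoc]

/-- A channel is determined by its values at two pure states, if these values are pure and not
orthogonal. -/
lemma eq_of_pairs {Φ Ψ : Module.End ℂ M2} (hΦ : Φ ∈ channels) (hΨ : Ψ ∈ channels)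
    {ρ σ : M2} (hρ : ρ ∈ pureStates) (hσ : σ ∈ pureStates) (hρ' : Φ ρ ∈ pureStates)
    (hσ' : Φ σ ∈ pureStates) (hne : ρ ≠ σ) (h1 : Ψ ρ = Φ ρ) (h2 : Ψ σ = Φ σ)
    (hlt : -1 < blochInner (Φ ρ) (Φ σ)) : Φ = Ψ := by
  obtain ⟨U, hU, hU1, hU2⟩ := exists_unitary_pair hρ hσ
  obtain ⟨V, hV, hV1, hV2⟩ := exists_unitary_pair hρ' hσ'
  obtain ⟨U', hU', -, hUU⟩ := exists_inverse hU
  obtain ⟨V', hV', -, hVV⟩ := exists_inverse hV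
  have hinv : ∀ X, U' (U X) = X := fun X => LinearMap.congr_fun hUU X
  have e : V * Φ * U' = V * Ψ * U' := by
    have b1 := blochInner_bounds hρ hσ
    have b2 := blochInner_bounds hρ' hσ'
    have hVc := unitaryChannels_subset_channels hV
    have hUc := unitaryChannels_subset_channels hU'
    refine eq_of_standard (z := blochInner ρ σ) (z' := blochInner (Φ ρ) (Φ σ))
      (mul_mem_channels (mul_mem_channels hVc hΦ) hUc)
      (mul_mem_channels (mul_mem_channels hVc hΨ) hUc) b1.1 (blochInner_lt_one hρ hσ hne) hlt b2.2
      ?_ ?_ ?_ ?_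
    · rw [← hU1, Module.End.mul_apply, hinv, Module.End.mul_apply, hV1, hU1]
    · rw [← hU1, Module.End.mul_apply, hinv, Module.End.mul_apply, h1, hV1, hU1]
    · rw [← hU2, Module.End.mul_apply, hinv, Module.End.mul_apply, hV2]
    · rw [← hU2, Module.End.mul_apply, hinv, Module.End.mul_apply, h2, hV2]
  calc Φ = (V' * V) * Φ * (U' * U) := by simp [hVV, hUU]
    _ = V' * (V * Φ * U') * U := by simp only [mul_assoc]
    _ = V' * (V * Ψ * U') * U := by rw [e]
    _ = (V' * V) * Ψ * (U' * U) := by simp only [mul_assoc]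
    _ = Ψ := by simp [hVV, hUU]

/-! ### The standard families and their pure outputs -/

lemma diagonalForm_apply (a b c t : ℝ) (X : M2) : diagonalForm a b c t X =
    !![((1 + t) * (X 0 0 + X 1 1) + c * (X 0 0 - X 1 1)) / 2,
        (a * (X 0 1 + X 1 0) + b * (X 0 1 - X 1 0)) / 2;
      (a * (X 0 1 + X 1 0) - b * (X 0 1 - X 1 0)) / 2,
        ((1 - t) * (X 0 0 + X 1 1) - c * (X 0 0 - X 1 1)) / 2] := by
  have hI := Complex.I_mul_I
  ext i j
  fin_cases i <;> fin_cases j <;>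
    simp [diagonalForm, ofTransferMatrix, Fin.sum_univ_four, pauli, Matrix.trace_fin_two,
      Matrix.mul_apply, Matrix.vecHead, Matrix.vecTail]
  · ring
  · linear_combination (b * (X 1 0 - X 0 1) / 2) * hI
  · linear_combination (-b * (X 1 0 - X 0 1) / 2) * hI
  · ring

lemma diagonalForm_bloch (a b c t x y z : ℝ) :
    diagonalForm a b c t (bloch x y z) = bloch (a * x) (b * y) (c * z + t) := by
  rw [diagonalForm_apply]
  ext i j
  fin_cases i <;> fin_cases j <;> simp [bloch] <;> ring

lemma onePO_eq_poleMap (lam : ℝ) : onePO lam = poleMap lam 0 (lam ^ 2) := by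
  refine LinearMap.ext fun X => ?_
  rw [onePO, diagonalForm_apply, poleMap_apply]
  ext i j
  fin_cases i <;> fin_cases j <;> simp <;> ring

lemma poleCond_normSq {b : ℂ} (hb : Complex.normSq b ≤ 1) : PoleCond b 0 (Complex.normSq b) :=
  ⟨hb, le_rfl, by simp⟩

lemma onePO_eq_poleMap_normSq (lam : ℝ) :
    onePO lam = poleMap lam 0 (Complex.normSq lam) := by
  rw [onePO_eq_poleMap, Complex.normSq_ofReal, sq]

lemma onePO_mem_channels {lam : ℝ} (h0 : 0 ≤ lam) (h1 : lam ≤ 1) : onePO lam ∈ channels := by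
  rw [onePO_eq_poleMap_normSq]
  exact poleMap_mem_channels (poleCond_normSq (by rw [Complex.normSq_ofReal]; nlinarith))

/-- Two Kraus operators suffice; their entries are sines and cosines of the half sum and half
difference of `u` and `v`. -/
lemma diagonalForm_cos_mem_channels (u v : ℝ) :
    diagonalForm (Real.cos u) (Real.cos v) (Real.cos u * Real.cos v) (Real.sin u * Real.sin v)
      ∈ channels := by
  refine ⟨?_, fun X => ?_⟩
  · have hu : u = (u - v) / 2 + (u + v) / 2 := by ring
    have hv : v = (u + v) / 2 - (u - v) / 2 := by ring
    set α := (u + v) / 2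
    set β := (u - v) / 2
    have key : diagonalForm (Real.cos u) (Real.cos v) (Real.cos u * Real.cos v)
        (Real.sin u * Real.sin v)
        = conjBy !![(Real.cos β : ℂ), 0; 0, Real.cos α]
        + conjBy !![0, -(Real.sin α : ℂ); Real.sin β, 0] := by
      have e1 : (Real.cos α : ℂ) ^ 2 = 1 - Real.sin α ^ 2 := by
        exact_mod_cast Real.cos_sq' α
      have e2 : (Real.cos β : ℂ) ^ 2 = 1 - Real.sin β ^ 2 := by
        exact_mod_cast Real.cos_sq' β
      rw [hu, hv, Real.cos_add, Real.cos_sub, Real.sin_add, Real.sin_sub]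
      refine LinearMap.ext fun X => ?_
      rw [diagonalForm_apply, LinearMap.add_apply, conjBy_apply, conjBy_apply]
      ext i j
      fin_cases i <;> fin_cases j <;> simp only [Matrix.add_apply, Matrix.mul_apply,
        Fin.sum_univ_two, Matrix.conjTranspose_apply] <;>
        simp [-Complex.ofReal_cos, -Complex.ofReal_sin]
      · ring_nf
        simp only [e1, e2]
        ring
      · ring
      · ring
      · ring_nf
        simp only [e1, e2]
        ring
    rw [key]
    exact (isCompletelyPositive_conjBy _).add (isCompletelyPositive_conjBy _)
  · rw [diagonalForm_apply]
    simp [Matrix.trace_fin_two]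
    ring

section TwoPO

variable {ω θ : ℝ}

lemma trig_facts (h0 : 0 ≤ θ) (h1 : θ < ω) (h2 : ω < Real.pi / 2) :
    0 < Real.cos ω ∧ 0 < Real.cos θ ∧ 0 < Real.sin ω ∧ 0 ≤ Real.sin θ ∧
      Real.sin θ < Real.sin ω ∧ Real.cos ω < Real.cos θ := by
  have hp := Real.pi_pos
  refine ⟨Real.cos_pos_of_mem_Ioo ⟨by linarith, h2⟩, Real.cos_pos_of_mem_Ioo ⟨by linarith, by linarith⟩,
    Real.sin_pos_of_pos_of_lt_pi (by linarith) (by linarith),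
    Real.sin_nonneg_of_nonneg_of_le_pi h0 (by linarith),
    Real.sin_lt_sin_of_lt_of_le_pi_div_two (by linarith) h2.le h1,
    Real.cos_lt_cos_of_nonneg_of_le_pi_div_two h0 h2.le h1⟩

/-- The translation satisfies t² = (1 − λ₁²)(1 − λ₂²) with t ≥ 0, so the trigonometric form applies
with u = arccos λ₁ and v = arccos λ₂. -/
lemma twoPO_mem_channels (h0 : 0 ≤ θ) (h1 : θ < ω) (h2 : ω < Real.pi / 2) :
    twoPO ω θ ∈ channels := by
  obtain ⟨hC, hc, hS, hs, hsS, hCc⟩ := trig_facts h0 h1 h2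
  have hl1 : Real.cos ω / Real.cos θ ≤ 1 := (div_le_one hc).mpr hCc.le
  have hl1' : 0 ≤ Real.cos ω / Real.cos θ := by positivity
  have hl2' : 0 ≤ Real.tan θ / Real.tan ω := by
    rw [Real.tan_eq_sin_div_cos, Real.tan_eq_sin_div_cos]; positivity
  have hl2 : Real.tan θ / Real.tan ω ≤ 1 := by
    rw [Real.tan_eq_sin_div_cos, Real.tan_eq_sin_div_cos, div_div_div_eq, div_le_one (by positivity)]
    nlinarith
  have key : twoPO ω θ = diagonalForm (Real.cos (Real.arccos (Real.cos ω / Real.cos θ)))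
      (Real.cos (Real.arccos (Real.tan θ / Real.tan ω)))
      (Real.cos (Real.arccos (Real.cos ω / Real.cos θ)) *
        Real.cos (Real.arccos (Real.tan θ / Real.tan ω)))
      (Real.sin (Real.arccos (Real.cos ω / Real.cos θ)) *
        Real.sin (Real.arccos (Real.tan θ / Real.tan ω))) := by
    rw [Real.cos_arccos (by linarith) hl1, Real.cos_arccos (by linarith) hl2,
      Real.sin_arccos, Real.sin_arccos, ← Real.sqrt_mul (by nlinarith), twoPO]
    congr 1
    symm
    rw [Real.sqrt_eq_iff_mul_self_eq (by apply mul_nonneg <;> nlinarith)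
      (div_nonneg (by nlinarith) (by positivity))]
    rw [Real.tan_eq_sin_div_cos, Real.tan_eq_sin_div_cos]
    field_simp
    have e1 := Real.sin_sq ω
    have e2 := Real.sin_sq θ
    rw [e1, e2]
    ring
  rw [key]
  exact diagonalForm_cos_mem_channels _ _

lemma twoPO_bloch_neg (h0 : 0 ≤ θ) (h1 : θ < ω) (h2 : ω < Real.pi / 2) :
    twoPO ω θ (bloch (-Real.cos θ) 0 (Real.sin θ)) = bloch (-Real.cos ω) 0 (Real.sin ω) := by
  obtain ⟨hC, hc, hS, hs, hsS, hCc⟩ := trig_facts h0 h1 h2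
  rw [twoPO, diagonalForm_bloch]
  congr 1
  · field_simp
  · ring
  · rw [Real.tan_eq_sin_div_cos, Real.tan_eq_sin_div_cos]
    field_simp
    rw [Real.sin_sq, Real.sin_sq]
    ring

lemma twoPO_bloch_pos (h0 : 0 ≤ θ) (h1 : θ < ω) (h2 : ω < Real.pi / 2) :
    twoPO ω θ (bloch (Real.cos θ) 0 (Real.sin θ)) = bloch (Real.cos ω) 0 (Real.sin ω) := by
  obtain ⟨hC, hc, hS, hs, hsS, hCc⟩ := trig_facts h0 h1 h2
  rw [twoPO, diagonalForm_bloch]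
  congr 1
  · field_simp
  · ring
  · rw [Real.tan_eq_sin_div_cos, Real.tan_eq_sin_div_cos]
    field_simp
    rw [Real.sin_sq, Real.sin_sq]
    ring

lemma bloch_cos_mem_pureStates (θ : ℝ) : bloch (Real.cos θ) 0 (Real.sin θ) ∈ pureStates :=
  bloch_mem_pureStates_iff.mpr (by linarith [Real.sin_sq_add_cos_sq θ])

lemma bloch_neg_cos_mem_pureStates (θ : ℝ) : bloch (-Real.cos θ) 0 (Real.sin θ) ∈ pureStates :=
  bloch_mem_pureStates_iff.mpr (by linarith [Real.sin_sq_add_cos_sq θ])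

lemma blochInner_cos (θ : ℝ) : blochInner (bloch (Real.cos θ) 0 (Real.sin θ))
    (bloch (-Real.cos θ) 0 (Real.sin θ)) = 2 * Real.sin θ ^ 2 - 1 := by
  rw [blochInner_bloch]
  linarith [Real.sin_sq_add_cos_sq θ]

lemma bloch_cos_ne (h : 0 < Real.cos θ) :
    bloch (Real.cos θ) 0 (Real.sin θ) ≠ bloch (-Real.cos θ) 0 (Real.sin θ) := fun he => by
  have := (bloch_injective he).1
  linarith

lemma pureOutput_twoPO (h0 : 0 ≤ θ) (h1 : θ < ω) (h2 : ω < Real.pi / 2) :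
    pureOutput (twoPO ω θ) =
      {bloch (Real.cos ω) 0 (Real.sin ω), bloch (-Real.cos ω) 0 (Real.sin ω)} := by
  obtain ⟨hC, hc, hS, hs, hsS, hCc⟩ := trig_facts h0 h1 h2
  refine Set.Subset.antisymm ?_ ?_
  · rintro _ ⟨⟨ρ, hρ, rfl⟩, hpure⟩
    obtain ⟨x, y, z, hr, rfl⟩ := mem_densityMatrices_iff.mp hρ
    have hp := hpure
    rw [twoPO, diagonalForm_bloch, bloch_mem_pureStates_iff] at hp
    -- Up to a positive factor, the deficit 1 − |r'|² of the image is a sum of three nonnegative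
    -- terms. All vanish only if |r| = 1, y = 0 and z = sin θ.
    have key : (1 - ((Real.cos ω / Real.cos θ * x) ^ 2 + (Real.tan θ / Real.tan ω * y) ^ 2
        + (Real.cos ω / Real.cos θ * (Real.tan θ / Real.tan ω) * z
          + (Real.cos θ ^ 2 - Real.cos ω ^ 2) / (Real.cos θ ^ 2 * Real.sin ω)) ^ 2))
        * (Real.cos θ ^ 4 * Real.sin ω ^ 2)
        = Real.cos ω ^ 2 * (Real.cos θ ^ 2 * Real.sin ω ^ 2 * (1 - (x ^ 2 + y ^ 2 + z ^ 2))
          + Real.cos θ ^ 2 * (Real.cos θ ^ 2 - Real.cos ω ^ 2) * y ^ 2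
          + (Real.cos θ ^ 2 - Real.cos ω ^ 2) * (z - Real.sin θ) ^ 2) := by
      rw [Real.tan_eq_sin_div_cos, Real.tan_eq_sin_div_cos]
      field_simp
      have e1 := Real.sin_sq ω
      have e2 := Real.sin_sq θ
      ring_nf
      simp only [e1, e2]
      ring
    rw [hp, sub_self, zero_mul] at key
    have hN : 0 < Real.cos θ ^ 2 - Real.cos ω ^ 2 := by nlinarith
    have key' := (mul_eq_zero.mp key.symm).resolve_left (by positivity)
    have t1 : 0 ≤ Real.cos θ ^ 2 * Real.sin ω ^ 2 * (1 - (x ^ 2 + y ^ 2 + z ^ 2)) :=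
      mul_nonneg (by positivity) (by linarith)
    have t2 : 0 ≤ Real.cos θ ^ 2 * (Real.cos θ ^ 2 - Real.cos ω ^ 2) * y ^ 2 := by positivity
    have t3 : 0 ≤ (Real.cos θ ^ 2 - Real.cos ω ^ 2) * (z - Real.sin θ) ^ 2 := by positivity
    have t1' : Real.cos θ ^ 2 * Real.sin ω ^ 2 * (1 - (x ^ 2 + y ^ 2 + z ^ 2)) = 0 := by linarith
    have t2' : Real.cos θ ^ 2 * (Real.cos θ ^ 2 - Real.cos ω ^ 2) * y ^ 2 = 0 := by linarith
    have t3' : (Real.cos θ ^ 2 - Real.cos ω ^ 2) * (z - Real.sin θ) ^ 2 = 0 := by linarith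
    have hy : y = 0 := by
      have := (mul_eq_zero.mp t2').resolve_left (by positivity)
      exact pow_eq_zero_iff (two_ne_zero) |>.mp this
    have hz : z = Real.sin θ := by
      have := (mul_eq_zero.mp t3').resolve_left hN.ne'
      exact sub_eq_zero.mp (pow_eq_zero_iff (two_ne_zero) |>.mp this)
    have hx := (mul_eq_zero.mp t1').resolve_left (by positivity)
    subst hy hz
    have hx' : x ^ 2 = Real.cos θ ^ 2 := by linarith [Real.sin_sq_add_cos_sq θ]
    rcases sq_eq_sq_iff_eq_or_eq_neg.mp hx' with rfl | rfl
    · exact Or.inl (twoPO_bloch_pos h0 h1 h2)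
    · exact Or.inr (twoPO_bloch_neg h0 h1 h2)
  · rintro _ (rfl | rfl)
    · exact ⟨⟨_, (bloch_cos_mem_pureStates θ).1, twoPO_bloch_pos h0 h1 h2⟩,
        bloch_cos_mem_pureStates ω⟩
    · exact ⟨⟨_, (bloch_neg_cos_mem_pureStates θ).1, twoPO_bloch_neg h0 h1 h2⟩,
        bloch_neg_cos_mem_pureStates ω⟩

/-- A channel with suitable inner products of pure inputs and pure outputs is unitarily equivalent
to a standard one. -/
lemma unitarilyEquivalent_twoPO (h0 : 0 ≤ θ) (h1 : θ < ω) (h2 : ω < Real.pi / 2)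
    {Φ : Module.End ℂ M2} (hΦ : Φ ∈ channels)
    {ρ σ : M2} (hρ : ρ ∈ pureStates) (hσ : σ ∈ pureStates) (hρ' : Φ ρ ∈ pureStates)
    (hσ' : Φ σ ∈ pureStates) (hin : blochInner ρ σ = 2 * Real.sin θ ^ 2 - 1)
    (hout : blochInner (Φ ρ) (Φ σ) = 2 * Real.sin ω ^ 2 - 1) :
    UnitarilyEquivalent Φ (twoPO ω θ) := by
  obtain ⟨hC, hc, hS, hs, hsS, hCc⟩ := trig_facts h0 h1 h2
  refine unitarilyEquivalent_of_pairs hΦ (twoPO_mem_channels h0 h1 h2) hρ hσ hρ' hσ'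
    (bloch_cos_mem_pureStates θ) (bloch_neg_cos_mem_pureStates θ) ?_ ?_ ?_ ?_ ?_ ?_
  · rw [twoPO_bloch_pos h0 h1 h2]; exact bloch_cos_mem_pureStates ω
  · rw [twoPO_bloch_neg h0 h1 h2]; exact bloch_neg_cos_mem_pureStates ω
  · rintro rfl
    rw [blochInner_self hρ] at hin
    nlinarith [Real.sin_sq_add_cos_sq θ]
  · rw [hin, blochInner_cos]
  · rw [twoPO_bloch_pos h0 h1 h2, twoPO_bloch_neg h0 h1 h2, hout, blochInner_cos]
  · rw [hout]; nlinarith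

/-- Every inner product in [−1, 1) is 2 sin² − 1 of a unique angle in [0, π/2). The strict increase
gives θ < ω, and distinct images give ω < π/2. -/
lemma exists_unitarilyEquivalent_twoPO {Φ : Module.End ℂ M2} (hΦ : Φ ∈ channels)
    {ρ σ : M2} (hρ : ρ ∈ pureStates) (hσ : σ ∈ pureStates) (hρ' : Φ ρ ∈ pureStates)
    (hσ' : Φ σ ∈ pureStates) (hlt : blochInner ρ σ < blochInner (Φ ρ) (Φ σ))
    (hne : Φ ρ ≠ Φ σ) :
    ∃ ω θ : ℝ, 0 ≤ θ ∧ θ < ω ∧ ω < Real.pi / 2 ∧ blochInner ρ σ = 2 * Real.sin θ ^ 2 - 1 ∧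
      blochInner (Φ ρ) (Φ σ) = 2 * Real.sin ω ^ 2 - 1 ∧ UnitarilyEquivalent Φ (twoPO ω θ) := by
  have b1 := blochInner_bounds hρ hσ
  have b2 := blochInner_lt_one hρ' hσ' hne
  have key : ∀ z : ℝ, -1 ≤ z → z < 1 → √((1 + z) / 2) < 1 ∧
      z = 2 * Real.sin (Real.arcsin √((1 + z) / 2)) ^ 2 - 1 := fun z hz hz1 => by
    have h1 : √((1 + z) / 2) < 1 := by
      rw [Real.sqrt_lt' one_pos]; linarith
    refine ⟨h1, ?_⟩
    rw [Real.sin_arcsin (by linarith [Real.sqrt_nonneg ((1 + z) / 2)]) h1.le,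
      Real.sq_sqrt (by linarith)]
    ring
  obtain ⟨k1, k2⟩ := key _ b1.1 (hlt.trans b2)
  obtain ⟨k3, k4⟩ := key _ (b1.1.trans hlt.le) b2
  have h0 : 0 ≤ Real.arcsin √((1 + blochInner ρ σ) / 2) :=
    Real.arcsin_nonneg.mpr (Real.sqrt_nonneg _)
  have h1 : Real.arcsin √((1 + blochInner ρ σ) / 2)
      < Real.arcsin √((1 + blochInner (Φ ρ) (Φ σ)) / 2) := by
    refine Real.arcsin_lt_arcsin (by linarith [Real.sqrt_nonneg ((1 + blochInner ρ σ) / 2)]) ?_ k3.le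
    exact Real.sqrt_lt_sqrt (by linarith) (by linarith)
  have h2 : Real.arcsin √((1 + blochInner (Φ ρ) (Φ σ)) / 2) < Real.pi / 2 :=
    Real.arcsin_lt_pi_div_two.mpr k3
  exact ⟨_, _, h0, h1, h2, k2, k4, unitarilyEquivalent_twoPO h0 h1 h2 hΦ hρ hσ hρ' hσ' k2 k4⟩

end TwoPO

/-! ### Extremality and pure outputs under unitary equivalence -/

lemma ofReal_smul_eq (a : ℝ) (Φ : M2 →ₗ[ℂ] M2) : (a : ℂ) • Φ = a • Φ := by
  refine LinearMap.ext fun X => ?_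
  ext i j
  simp

lemma mem_extremalChannels_iff {Φ : M2 →ₗ[ℂ] M2} : Φ ∈ extremalChannels ↔ Φ ∈ channels ∧
    ∀ Φ₁ ∈ channels, ∀ Φ₂ ∈ channels, ∀ a b : ℝ, 0 < a → 0 < b → a + b = 1 →
      (a : ℂ) • Φ₁ + (b : ℂ) • Φ₂ = Φ → Φ₁ = Φ := by
  rw [extremalChannels, mem_extremePoints_iff_left]
  refine and_congr_right fun _ => ⟨fun h Φ₁ h1 Φ₂ h2 a b ha hb hab he => ?_,
    fun h Φ₁ h1 Φ₂ h2 hm => ?_⟩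
  · exact h Φ₁ h1 Φ₂ h2 ⟨a, b, ha, hb, hab, by simpa only [ofReal_smul_eq] using he⟩
  · obtain ⟨a, b, ha, hb, hab, he⟩ := hm
    exact h Φ₁ h1 Φ₂ h2 a b ha hb hab (by simpa only [ofReal_smul_eq] using he)

lemma extremal_subset_channels : extremalChannels ⊆ channels := fun _ h =>
  (mem_extremalChannels_iff.mp h).1

lemma UnitarilyEquivalent.mem_channels {Φ Ψ : Module.End ℂ M2} (h : UnitarilyEquivalent Φ Ψ)
    (hΨ : Ψ ∈ channels) : Φ ∈ channels := by
  obtain ⟨U, V, hU, hV, rfl⟩ := unitarilyEquivalent_iff.mp h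
  exact mul_mem_channels (mul_mem_channels (unitaryChannels_subset_channels hU) hΨ)
    (unitaryChannels_subset_channels hV)

lemma UnitarilyEquivalent.mem_extremalChannels {Φ Ψ : Module.End ℂ M2}
    (h : UnitarilyEquivalent Φ Ψ) (hΨ : Ψ ∈ extremalChannels) : Φ ∈ extremalChannels := by
  rw [mem_extremalChannels_iff] at hΨ ⊢
  refine ⟨h.mem_channels hΨ.1, fun Φ₁ h1 Φ₂ h2 a b ha hb hab he => ?_⟩
  obtain ⟨U, V, hU, hV, rfl⟩ := unitarilyEquivalent_iff.mp h
  obtain ⟨U', hU', hUU, hUU'⟩ := exists_inverse hU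
  obtain ⟨V', hV', hVV, hVV'⟩ := exists_inverse hV
  have hmem : ∀ Ξ : Module.End ℂ M2, Ξ ∈ channels → U' * Ξ * V' ∈ channels := fun Ξ hΞ =>
    mul_mem_channels (mul_mem_channels (unitaryChannels_subset_channels hU') hΞ)
      (unitaryChannels_subset_channels hV')
  have key : U' * (Φ₁ : Module.End ℂ M2) * V' = Ψ := by
    refine hΨ.2 _ (hmem _ h1) _ (hmem Φ₂ h2) a b ha hb hab ?_
    calc (a : ℂ) • (U' * (Φ₁ : Module.End ℂ M2) * V') + (b : ℂ) • (U' * (Φ₂ : Module.End ℂ M2) * V')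
        = U' * ((a : ℂ) • (Φ₁ : Module.End ℂ M2) + (b : ℂ) • (Φ₂ : Module.End ℂ M2)) * V' := by
          simp only [mul_add, add_mul, mul_smul_comm, smul_mul_assoc]
      _ = U' * (U * Ψ * V) * V' := by rw [he]
      _ = (U' * U) * Ψ * (V * V') := by simp only [mul_assoc]
      _ = Ψ := by simp [hUU', hVV]
  calc (Φ₁ : Module.End ℂ M2) = (U * U') * Φ₁ * (V' * V) := by simp [hUU, hVV']
    _ = U * (U' * Φ₁ * V') * V := by simp only [mul_assoc]
    _ = U * Ψ * V := by rw [key]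

lemma UnitarilyEquivalent.pureOutput {Φ Ψ : Module.End ℂ M2} (h : UnitarilyEquivalent Φ Ψ) :
    ∃ U : Module.End ℂ M2, Function.Injective U ∧ pureOutput Φ = U '' pureOutput Ψ := by
  obtain ⟨U, V, hU, hV, rfl⟩ := unitarilyEquivalent_iff.mp h
  obtain ⟨U', hU', -, hUU'⟩ := exists_inverse hU
  obtain ⟨V', hV', hVV, -⟩ := exists_inverse hV
  have hinv : ∀ X, U' (U X) = X := fun X => LinearMap.congr_fun hUU' X
  refine ⟨U, Function.LeftInverse.injective hinv, Set.Subset.antisymm ?_ ?_⟩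
  · rintro _ ⟨⟨ρ, hρ, rfl⟩, hp⟩
    refine ⟨Ψ (V ρ), ⟨⟨V ρ, map_mem_densityMatrices (unitaryChannels_subset_channels hV) hρ, rfl⟩,
      ?_⟩, rfl⟩
    have := map_mem_pureStates hU' hp
    rwa [Module.End.mul_apply, Module.End.mul_apply, hinv] at this
  · rintro _ ⟨_, ⟨⟨ρ, hρ, rfl⟩, hp⟩, rfl⟩
    refine ⟨⟨V' ρ, map_mem_densityMatrices (unitaryChannels_subset_channels hV') hρ, ?_⟩,
      map_mem_pureStates hU hp⟩
    rw [Module.End.mul_apply, Module.End.mul_apply]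
    exact congr_arg (fun X => U (Ψ X)) (LinearMap.congr_fun hVV ρ)

/-! ### Transfer matrices -/

lemma isHermitian_map {Φ : M2 →ₗ[ℂ] M2} (hΦ : Φ ∈ channels) (x y z x' y' z' a : ℝ) :
    (Φ (bloch x y z + (a : ℂ) • bloch x' y' z')).IsHermitian := by
  have hs : ∀ (c : ℝ) (M : M2), M.IsHermitian → ((c : ℂ) • M).IsHermitian := fun c M hM => by
    rw [Matrix.IsHermitian, Matrix.conjTranspose_smul, hM.eq]
    simp
  have hall : ∀ x y z : ℝ, (Φ (bloch x y z)).IsHermitian := by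
    have hp : ∀ x y z : ℝ, x ^ 2 + y ^ 2 + z ^ 2 ≤ 1 → (Φ (bloch x y z)).IsHermitian :=
      fun x y z h => (map_mem_densityMatrices hΦ (bloch_mem_densityMatrices_iff.mpr h)).1.1
    intro x y z
    have e : bloch x y z = (x : ℂ) • bloch 1 0 0 + (y : ℂ) • bloch 0 1 0 + (z : ℂ) • bloch 0 0 1
        + ((1 - x - y - z : ℝ) : ℂ) • bloch 0 0 0 := by
      ext i j
      fin_cases i <;> fin_cases j <;> simp [bloch] <;> ring
    rw [e]
    simp only [map_add, map_smul]
    exact (((hs _ _ (hp _ _ _ (by norm_num))).add (hs _ _ (hp _ _ _ (by norm_num)))).add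
      (hs _ _ (hp _ _ _ (by norm_num)))).add (hs _ _ (hp _ _ _ (by norm_num)))
  rw [map_add, map_smul]
  exact (hall _ _ _).add (hs _ _ (hall _ _ _))

lemma isHermitian_map_pauli {Φ : M2 →ₗ[ℂ] M2} (hΦ : Φ ∈ channels) (j : Fin 4) :
    (Φ (pauli j)).IsHermitian := by
  have h0 := isHermitian_map hΦ 0 0 1 0 0 (-1) 1
  have h1 := isHermitian_map hΦ 1 0 0 (-1) 0 0 (-1)
  have h2 := isHermitian_map hΦ 0 1 0 0 (-1) 0 (-1)
  have h3 := isHermitian_map hΦ 0 0 1 0 0 (-1) (-1)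
  have e0 : bloch 0 0 1 + ((1 : ℝ) : ℂ) • bloch 0 0 (-1) = pauli 0 := by
    ext i j; fin_cases i <;> fin_cases j <;> simp [bloch, pauli]
  have e1 : bloch 1 0 0 + ((-1 : ℝ) : ℂ) • bloch (-1) 0 0 = pauli 1 := by
    ext i j; fin_cases i <;> fin_cases j <;> simp [bloch, pauli] <;> ring
  have e2 : bloch 0 1 0 + ((-1 : ℝ) : ℂ) • bloch 0 (-1) 0 = pauli 2 := by
    ext i j; fin_cases i <;> fin_cases j <;> simp [bloch, pauli] <;> ring
  have e3 : bloch 0 0 1 + ((-1 : ℝ) : ℂ) • bloch 0 0 (-1) = pauli 3 := by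
    ext i j; fin_cases i <;> fin_cases j <;> simp [bloch, pauli]
  fin_cases j
  · rw [e0] at h0; exact h0
  · rw [e1] at h1; exact h1
  · rw [e2] at h2; exact h2
  · rw [e3] at h3; exact h3

lemma eq_sum_pauli {X : M2} (hX : X.IsHermitian) :
    X = ∑ k, (((pauli k * X).trace.re / 2 : ℝ) : ℂ) • pauli k := by
  have h00 : (X 0 0).im = 0 := Complex.conj_eq_iff_im.mp (hX.apply 0 0)
  have h11 : (X 1 1).im = 0 := Complex.conj_eq_iff_im.mp (hX.apply 1 1)
  have h01 := hX.apply 0 1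
  have hre := congr_arg Complex.re h01
  have him := congr_arg Complex.im h01
  simp at hre him
  ext i j
  fin_cases i <;> fin_cases j <;> refine Complex.ext ?_ ?_ <;>
    simp only [Matrix.sum_apply, Matrix.smul_apply, Matrix.trace_fin_two, Matrix.mul_apply,
      Fin.sum_univ_two, Fin.sum_univ_four] <;>
    simp [pauli, h00, h11]
    <;> linarith

/-- The definition keeps only real parts, so multiplicativity relies on `Ψ` sending Pauli matrices
to Hermitian matrices, whose Pauli coefficients are real. -/
lemma transferMatrix_mul {Φ Ψ : Module.End ℂ M2} (hΨ : Ψ ∈ channels) :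
    transferMatrix (Φ * Ψ) = transferMatrix Φ * transferMatrix Ψ := by
  ext i j
  rw [Matrix.mul_apply]
  have h := eq_sum_pauli (isHermitian_map_pauli hΨ j)
  have e : transferMatrix (Φ * Ψ) i j = ((pauli i * Φ (Ψ (pauli j))).trace).re / 2 := rfl
  rw [e, h, map_sum, Finset.mul_sum, Matrix.trace_sum, Complex.re_sum, Finset.sum_div]
  refine Finset.sum_congr rfl fun k _ => ?_
  rw [map_smul, mul_smul_comm, Matrix.trace_smul, smul_eq_mul, Complex.re_ofReal_mul,
    transferMatrix, transferMatrix]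
  ring

lemma transferMatrix_one : transferMatrix (1 : Module.End ℂ M2) = 1 := by
  ext i j
  fin_cases i <;> fin_cases j <;>
    simp [transferMatrix, pauli, Matrix.trace_fin_two, Matrix.vecHead, Matrix.vecTail]

lemma UnitarilyEquivalent.isDegenerate_iff {Φ Ψ : Module.End ℂ M2} (h : UnitarilyEquivalent Φ Ψ)
    (hΨ : Ψ ∈ channels) : IsDegenerate Φ ↔ IsDegenerate Ψ := by
  obtain ⟨U, V, hU, hV, rfl⟩ := unitarilyEquivalent_iff.mp h
  have hne : ∀ W : Module.End ℂ M2, W ∈ unitaryChannels → (transferMatrix W).det ≠ 0 := by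
    intro W hW h0
    obtain ⟨W', hW', h1, -⟩ := exists_inverse hW
    have := congr_arg Matrix.det (transferMatrix_mul (Φ := W) (unitaryChannels_subset_channels hW'))
    rw [h1, transferMatrix_one, Matrix.det_mul, h0] at this
    simp at this
  rw [IsDegenerate, IsDegenerate, transferMatrix_mul (unitaryChannels_subset_channels hV),
    transferMatrix_mul hΨ, Matrix.det_mul, Matrix.det_mul]
  simp [hne U hU, hne V hV]

lemma det_transferMatrix_diagonalForm (a b c t : ℝ) :
    (transferMatrix (diagonalForm a b c t)).det = a * b * c := by
  have h : transferMatrix (diagonalForm a b c t)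
      = !![1, 0, 0, 0; 0, a, 0, 0; 0, 0, b, 0; t, 0, 0, c] := by
    ext i j
    rw [transferMatrix, diagonalForm_apply]
    fin_cases i <;> fin_cases j <;>
      simp [pauli, Matrix.trace_fin_two, Matrix.vecHead, Matrix.vecTail] <;> ring
  rw [h, Matrix.det_succ_row_zero]
  simp [Fin.sum_univ_four, Matrix.det_fin_three]

/-! ### The standard channels are extremal -/

/-- Pure states are extreme points, so both channels in a decomposition agree with `Φ` at ρ and σ;
`eq_of_pairs` does the rest. -/
lemma mem_extremalChannels_of_pairs {Φ : Module.End ℂ M2} (hΦ : Φ ∈ channels)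
    {ρ σ : M2} (hρ : ρ ∈ pureStates) (hσ : σ ∈ pureStates) (hρ' : Φ ρ ∈ pureStates)
    (hσ' : Φ σ ∈ pureStates) (hne : ρ ≠ σ) (hlt : -1 < blochInner (Φ ρ) (Φ σ)) :
    Φ ∈ extremalChannels := by
  rw [mem_extremalChannels_iff]
  refine ⟨hΦ, fun Φ₁ h1 Φ₂ h2 a b ha hb hab he => ?_⟩
  have key : ∀ τ ∈ pureStates, Φ τ ∈ pureStates → Φ₁ τ = Φ τ := fun τ hτ hτ' =>
    (eq_of_convex_combination hτ' (map_mem_densityMatrices h1 hτ.1)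
      (map_mem_densityMatrices h2 hτ.1) ha hb (by rw [← he]; rfl)).1
  exact (eq_of_pairs hΦ h1 hρ hσ hρ' hσ' hne (key ρ hρ hρ') (key σ hσ hσ') hlt).symm

lemma twoPO_mem_extremalChannels {ω θ : ℝ} (h0 : 0 ≤ θ) (h1 : θ < ω) (h2 : ω < Real.pi / 2) :
    twoPO ω θ ∈ extremalChannels := by
  obtain ⟨hC, hc, hS, hs, hsS, hCc⟩ := trig_facts h0 h1 h2
  have e1 := twoPO_bloch_pos h0 h1 h2
  have e2 := twoPO_bloch_neg h0 h1 h2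
  refine mem_extremalChannels_of_pairs (twoPO_mem_channels h0 h1 h2)
    (bloch_cos_mem_pureStates θ) (bloch_neg_cos_mem_pureStates θ) ?_ ?_ (bloch_cos_ne hc) ?_
  · rw [e1]; exact bloch_cos_mem_pureStates ω
  · rw [e2]; exact bloch_neg_cos_mem_pureStates ω
  · rw [e1, e2, blochInner_cos]; nlinarith

lemma pole_mem_pureStates : bloch 0 0 1 ∈ pureStates := bloch_mem_pureStates_iff.mpr (by norm_num)

/-- Both channels in a decomposition fix the pole, hence are `poleMap`s with |bᵢ|² ≤ sᵢ. Their
averages satisfy |b|² = s, so strict convexity of |·|² forces b₁ = b₂, then equality in each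
constraint, which kills the yᵢ. -/
lemma poleMap_mem_extremalChannels {b : ℂ} (hb : Complex.normSq b ≤ 1) :
    poleMap b 0 (Complex.normSq b) ∈ extremalChannels := by
  rw [mem_extremalChannels_iff]
  refine ⟨poleMap_mem_channels (poleCond_normSq hb), fun Φ₁ h1 Φ₂ h2 a c ha hc hac he => ?_⟩
  have hp := poleMap_pole b 0 (Complex.normSq b)
  have hpure : poleMap b 0 (Complex.normSq b) (bloch 0 0 1) ∈ pureStates := by
    rw [hp]; exact pole_mem_pureStates
  obtain ⟨e1, e2⟩ := eq_of_convex_combination hpure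
    (map_mem_densityMatrices h1 pole_mem_pureStates.1)
    (map_mem_densityMatrices h2 pole_mem_pureStates.1) ha hc (by rw [← he]; rfl)
  rw [hp] at e1 e2
  obtain ⟨b₁, y₁, s₁, c1, rfl⟩ := exists_poleMap h1 e1
  obtain ⟨b₂, y₂, s₂, c2, rfl⟩ := exists_poleMap h2 e2
  have hb12 := congr_fun₂ (LinearMap.congr_fun he (single 0 1 1)) 0 1
  have hs12 := congr_fun₂ (LinearMap.congr_fun he (single 1 1 1)) 1 1
  simp [poleMap_apply] at hb12 hs12
  have hs : a * s₁ + c * s₂ = Complex.normSq b := by exact_mod_cast hs12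
  have n1 := c1.normSq_le
  have n2 := c2.normSq_le
  have n1' := mul_le_mul_of_nonneg_left n1 ha.le
  have n2' := mul_le_mul_of_nonneg_left n2 hc.le
  have hcc : c = 1 - a := by linarith
  have hid : a * Complex.normSq b₁ + c * Complex.normSq b₂
      = Complex.normSq b + a * c * Complex.normSq (b₁ - b₂) := by
    rw [← hb12, hcc]
    simp only [Complex.normSq_apply, Complex.add_re, Complex.add_im, Complex.sub_re,
      Complex.sub_im, Complex.re_ofReal_mul, Complex.im_ofReal_mul]
    ring
  have h0 : Complex.normSq (b₁ - b₂) = 0 := by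
    have hac' := mul_pos ha hc
    have hn := mul_nonneg hac'.le (Complex.normSq_nonneg (b₁ - b₂))
    have : a * c * Complex.normSq (b₁ - b₂) = 0 := by linarith
    exact (mul_eq_zero.mp this).resolve_left hac'.ne'
  have hbb : b₁ = b₂ := sub_eq_zero.mp (Complex.normSq_eq_zero.mp h0)
  have hb1 : b₁ = b := by
    rw [← hb12, ← hbb, ← add_mul]
    have : (a : ℂ) + c = 1 := by exact_mod_cast hac
    rw [this, one_mul]
  rw [← hbb, hb1] at n2 n2'
  rw [hb1] at n1 n1'
  have hs1 : s₁ = Complex.normSq b := by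
    have : a * s₁ = a * Complex.normSq b := by
      have : a * Complex.normSq b + c * Complex.normSq b = Complex.normSq b := by
        rw [← add_mul, hac, one_mul]
      linarith
    exact mul_left_cancel₀ ha.ne' this
  have hy : y₁ = 0 := by
    have := c1.normSq_le_mul
    rw [hs1, hb1, sub_self, mul_zero] at this
    exact Complex.normSq_eq_zero.mp (le_antisymm this (Complex.normSq_nonneg _))
  rw [hb1, hs1, hy]

lemma onePO_mem_extremalChannels {lam : ℝ} (h0 : 0 ≤ lam) (h1 : lam ≤ 1) :
    onePO lam ∈ extremalChannels := by
  rw [onePO_eq_poleMap_normSq]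
  exact poleMap_mem_extremalChannels (by rw [Complex.normSq_ofReal]; nlinarith)

lemma pureOutput_onePO {lam : ℝ} (h0 : 0 < lam) (h1 : lam < 1) :
    pureOutput (onePO lam) = {bloch 0 0 1} := by
  refine Set.Subset.antisymm ?_ ?_
  · rintro _ ⟨⟨ρ, hρ, rfl⟩, hp⟩
    obtain ⟨x, y, z, hr, rfl⟩ := mem_densityMatrices_iff.mp hρ
    rw [onePO, diagonalForm_bloch] at hp ⊢
    rw [bloch_mem_pureStates_iff] at hp
    have hz : z = 1 := by
      have hl : lam ^ 2 < 1 := by nlinarith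
      have hl0 : 0 < lam ^ 2 := by positivity
      -- The left side is the deficit 1 − |r'|² of the image of a unit vector, and a lower bound for
      -- it on the whole ball.
      have key : lam ^ 2 * (1 - lam ^ 2) * (1 - z) ^ 2 ≤ 0 := by nlinarith
      have : 0 < lam ^ 2 * (1 - lam ^ 2) := mul_pos hl0 (by linarith)
      have h2 : (1 - z) ^ 2 ≤ 0 := nonpos_of_mul_nonpos_right key this
      have := pow_eq_zero_iff two_ne_zero |>.mp (le_antisymm h2 (sq_nonneg _))
      linarith
    subst hz
    have hx : x = 0 := by nlinarith [sq_nonneg x, sq_nonneg y]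
    have hy : y = 0 := by nlinarith [sq_nonneg x, sq_nonneg y]
    subst hx hy
    simp
  · rintro _ rfl
    refine ⟨⟨_, pole_mem_pureStates.1, ?_⟩, pole_mem_pureStates⟩
    rw [onePO_eq_poleMap, poleMap_pole]

/-- A channel that is unitarily equivalent to a non-degenerate `onePO`. -/
lemma UnitarilyEquivalent.mem_extremal1POnd {Φ : Module.End ℂ M2} {lam : ℝ} (h0 : 0 < lam)
    (h1 : lam < 1) (h : UnitarilyEquivalent Φ (onePO lam)) : Φ ∈ extremal1POnd := by
  obtain ⟨U, -, hU⟩ := h.pureOutput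
  refine ⟨h.mem_extremalChannels (onePO_mem_extremalChannels h0.le h1.le), ⟨U (bloch 0 0 1), ?_⟩, ?_⟩
  · rw [hU, pureOutput_onePO h0 h1, Set.image_singleton]
  · rw [h.isDegenerate_iff (onePO_mem_channels h0.le h1.le), IsDegenerate, onePO,
      det_transferMatrix_diagonalForm]
    positivity

section TwoPO

variable {ω θ : ℝ}

lemma UnitarilyEquivalent.two_pureOutputs (h0 : 0 ≤ θ) (h1 : θ < ω)
    (h2 : ω < Real.pi / 2) {Φ : Module.End ℂ M2} (h : UnitarilyEquivalent Φ (twoPO ω θ)) :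
    ∃ ξ ζ, ξ ≠ ζ ∧ QubitChannel.pureOutput Φ = {ξ, ζ} := by
  obtain ⟨hC, -⟩ := trig_facts h0 h1 h2
  obtain ⟨U, hinj, hU⟩ := h.pureOutput
  exact ⟨_, _, hinj.ne (bloch_cos_ne hC), by rw [hU, pureOutput_twoPO h0 h1 h2, Set.image_pair]⟩

lemma UnitarilyEquivalent.mem_extremal2POdeg (h1 : 0 < ω) (h2 : ω < Real.pi / 2)
    {Φ : Module.End ℂ M2} (h : UnitarilyEquivalent Φ (twoPO ω 0)) : Φ ∈ extremal2POdeg := by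
  refine ⟨h.mem_extremalChannels (twoPO_mem_extremalChannels le_rfl h1 h2),
    h.two_pureOutputs le_rfl h1 h2, ?_⟩
  rw [h.isDegenerate_iff (twoPO_mem_channels le_rfl h1 h2), IsDegenerate, twoPO,
      det_transferMatrix_diagonalForm]
  simp

lemma UnitarilyEquivalent.mem_extremal2POnd (h0 : 0 < θ) (h1 : θ < ω) (h2 : ω < Real.pi / 2)
    {Φ : Module.End ℂ M2} (h : UnitarilyEquivalent Φ (twoPO ω θ)) : Φ ∈ extremal2POnd := by
  refine ⟨h.mem_extremalChannels (twoPO_mem_extremalChannels h0.le h1 h2),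
    h.two_pureOutputs h0.le h1 h2, ?_⟩
  obtain ⟨hC, hc, hS, -⟩ := trig_facts h0.le h1 h2
  have hs : 0 < Real.sin θ := Real.sin_pos_of_pos_of_lt_pi h0 (by linarith [Real.pi_pos])
  rw [h.isDegenerate_iff (twoPO_mem_channels h0.le h1 h2), IsDegenerate, twoPO,
      det_transferMatrix_diagonalForm, Real.tan_eq_sin_div_cos, Real.tan_eq_sin_div_cos]
  positivity

end TwoPO

lemma constantChannel_mem_extremal1POdeg {ψ : M2} (hψ : ψ ∈ pureStates)
    (hch : constantChannel ψ ∈ channels) : constantChannel ψ ∈ extremal1POdeg := by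
  have hval : ∀ ρ ∈ densityMatrices, constantChannel ψ ρ = ψ := fun ρ hρ => by
    rw [constantChannel_apply, hρ.2, one_smul]
  refine ⟨?_, ⟨ψ, Set.Subset.antisymm ?_ ?_⟩, ?_⟩
  · rw [mem_extremalChannels_iff]
    refine ⟨hch, fun Φ₁ h1 Φ₂ h2 a b ha hb hab he => ext_pureStates fun ρ hρ => ?_⟩
    refine (eq_of_convex_combination ?_ (map_mem_densityMatrices h1 hρ.1)
      (map_mem_densityMatrices h2 hρ.1) ha hb (by rw [← he]; rfl)).1
    rw [hval ρ hρ.1]; exact hψ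
  · rintro _ ⟨⟨ρ, hρ, rfl⟩, -⟩
    exact hval ρ hρ
  · intro ξ hξ
    rw [hξ]
    exact ⟨⟨ψ, hψ.1, hval ψ hψ.1⟩, hψ⟩
  -- The map kills the traceless matrix σ₃.
  · refine Matrix.det_eq_zero_of_column_eq_zero 3 fun i => ?_
    simp [transferMatrix, constantChannel_apply, pauli, Matrix.trace_fin_two]

/-! ### Extremal channels have a pure output -/

lemma eq_zero_of_perturbation {Φ Δ : M2 →ₗ[ℂ] M2} (hΦ : Φ ∈ extremalChannels)
    (h1 : Φ + Δ ∈ channels) (h2 : Φ - Δ ∈ channels) : Δ = 0 := by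
  have := (mem_extremalChannels_iff.mp hΦ).2 _ h1 _ h2 (1 / 2) (1 / 2) (by norm_num) (by norm_num)
    (by norm_num) (by push_cast; module)
  simpa using this

-- Take δ = 1/(‖K‖ + 1), using ±K ≤ ‖K‖; the added 1 covers `K = 0`.
open scoped MatrixOrder Matrix.Norms.L2Operator in
lemma exists_posSemidef_one_add_smul {n : Type*} [Fintype n] [DecidableEq n] {K : Matrix n n ℂ}
    (hK : K.IsHermitian) :
    ∃ δ : ℝ, 0 < δ ∧ (1 + (δ : ℂ) • K).PosSemidef ∧ (1 - (δ : ℂ) • K).PosSemidef := by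
  have hle : ∀ M : Matrix n n ℂ, M.IsHermitian → ‖M‖ ≤ ‖K‖ →
      (1 - ((1 / (‖K‖ + 1) : ℝ) : ℂ) • M).PosSemidef := by
    intro M hM hn
    have h1 : M ≤ algebraMap ℝ _ ‖M‖ := IsSelfAdjoint.le_algebraMap_norm_self hM
    rw [Matrix.le_iff] at h1
    have hpos : 0 < ‖K‖ + 1 := by positivity
    have h2 : ((((‖K‖ + 1 - ‖M‖) / (‖K‖ + 1) : ℝ) : ℂ) • (1 : Matrix n n ℂ)).PosSemidef := by
      refine Matrix.PosSemidef.one.smul ?_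
      have : 0 ≤ (‖K‖ + 1 - ‖M‖) / (‖K‖ + 1) := div_nonneg (by linarith) hpos.le
      exact_mod_cast this
    have h3 : ((1 / (‖K‖ + 1) : ℝ) : ℂ) • (algebraMap ℝ (Matrix n n ℂ) ‖M‖ - M)
        + (((‖K‖ + 1 - ‖M‖) / (‖K‖ + 1) : ℝ) : ℂ) • (1 : Matrix n n ℂ)
        = 1 - ((1 / (‖K‖ + 1) : ℝ) : ℂ) • M := by
      have e : algebraMap ℝ (Matrix n n ℂ) ‖M‖ = ((‖M‖ : ℝ) : ℂ) • (1 : Matrix n n ℂ) := by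
        rw [Algebra.algebraMap_eq_smul_one]
        ext i j
        simp
      rw [e, smul_sub, smul_smul, sub_add_eq_add_sub, ← add_smul]
      congr 1
      have : ((1 / (‖K‖ + 1) : ℝ) : ℂ) * (‖M‖ : ℝ) + (((‖K‖ + 1 - ‖M‖) / (‖K‖ + 1) : ℝ) : ℂ) = 1 := by
        rw [← Complex.ofReal_mul, ← Complex.ofReal_add, ← Complex.ofReal_one]
        congr 1
        field_simp
        ring
      rw [this, one_smul]
    rw [← h3]
    refine (h1.smul ?_).add h2
    have : 0 ≤ 1 / (‖K‖ + 1) := by positivity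
    exact_mod_cast this
  refine ⟨1 / (‖K‖ + 1), by positivity, ?_, hle K hK le_rfl⟩
  have := hle (-K) hK.neg (norm_neg K).le
  simpa using this

/-- A kernel vector of the Choi matrix that is a product vector yields a pure output. -/
lemma exists_pureStates_of_choi_ker {Φ : M2 →ₗ[ℂ] M2} (hΦ : Φ ∈ channels)
    {v : Fin 2 × Fin 2 → ℂ} (hv : v ≠ 0) (hker : choi Φ *ᵥ v = 0)
    (hdet : v (0, 0) * v (1, 1) = v (0, 1) * v (1, 0)) : ∃ ρ ∈ pureStates, Φ ρ ∈ pureStates := by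
  -- Read as a 2 × 2 matrix, `v` is singular, hence a product vector x ⊗ f. The pure input is the
  -- projection onto the conjugate of `x`; its image has `f` in the kernel, because the form of the
  -- image at `f` is a multiple of that of the Choi matrix at `v`.
  obtain ⟨x, f, hxf⟩ : ∃ x f : Fin 2 → ℂ, ∀ i a, v (i, a) = x i * f a := by
    have hd : (Matrix.of fun i a => v (i, a) : M2).det = 0 := by
      rw [Matrix.det_fin_two]
      simp [hdet]
    obtain ⟨g, hg, hg0⟩ := Matrix.exists_mulVec_eq_zero_iff.mpr hd
    have hg' : ∀ i, v (i, 0) * g 0 + v (i, 1) * g 1 = 0 := fun i => by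
      have := congr_fun hg0 i
      simpa [Matrix.mulVec, dotProduct, Fin.sum_univ_two] using this
    by_cases h0 : g 0 = 0
    · have h1 : g 1 ≠ 0 := fun h1 => hg (by ext i; fin_cases i <;> simp [h0, h1])
      have hv1 : ∀ i, v (i, 1) = 0 := fun i => by
        have := hg' i
        rw [h0, mul_zero, zero_add] at this
        exact (mul_eq_zero.mp this).resolve_right h1
      refine ⟨fun i => v (i, 0), ![1, 0], fun i a => ?_⟩
      fin_cases a <;> simp [hv1]
    · refine ⟨fun i => v (i, 1) / g 0, ![-g 1, g 0], fun i a => ?_⟩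
      fin_cases a
      · simp
        field_simp
        linear_combination hg' i
      · simp [h0]
  have hx : x ≠ 0 := by
    rintro rfl
    exact hv (by ext ⟨i, a⟩; simp [hxf])
  have hf : f ≠ 0 := by
    rintro rfl
    exact hv (by ext ⟨i, a⟩; simp [hxf])
  have hN : 0 < star x ⬝ᵥ x := by
    exact Matrix.dotProduct_star_self_pos_iff.mpr hx
  have hρ : (star x ⬝ᵥ x)⁻¹ • vecMulVec (star x) x ∈ pureStates := by
    rw [mem_pureStates_iff_det]
    refine ⟨⟨Matrix.PosSemidef.smul ?_ (inv_nonneg.mpr hN.le), ?_⟩, ?_⟩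
    · simpa using posSemidef_vecMulVec_self_star (star x)
    · rw [Matrix.trace_smul, Matrix.trace_vecMulVec, smul_eq_mul, inv_mul_cancel₀ hN.ne']
    · rw [Matrix.det_fin_two]
      simp [vecMulVec_apply]
      ring
  refine ⟨_, hρ, ?_⟩
  have hout := map_mem_densityMatrices hΦ hρ.1
  refine mem_pureStates_iff_det.mpr ⟨hout, Matrix.exists_mulVec_eq_zero_iff.mp ⟨f, hf, ?_⟩⟩
  refine (hout.1.dotProduct_mulVec_zero_iff f).mp ?_
  have e : star f ⬝ᵥ (Φ (vecMulVec (star x) x) *ᵥ f) = star v ⬝ᵥ (choi Φ *ᵥ v) := by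
    rw [apply_eq_sum]
    simp only [dotProduct, Matrix.mulVec, Fintype.sum_prod_type, Fin.sum_univ_two, choi_apply,
      Matrix.add_apply, Matrix.smul_apply, vecMulVec_apply, Pi.star_apply, hxf, star_mul',
      smul_eq_mul]
    ring
  rw [map_smul, Matrix.smul_mulVec, dotProduct_smul, e, hker, dotProduct_zero, smul_zero]

/-- The Choi matrix of an extremal channel has rank at most two. -/
lemma two_le_finrank_ker_choi {Φ : M2 →ₗ[ℂ] M2} (hΦ : Φ ∈ extremalChannels) :
    2 ≤ Module.finrank ℂ (LinearMap.ker (choi Φ).mulVecLin) := by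
  by_contra! hlt
  have hch := extremal_subset_channels hΦ
  have hC := posSemidef_choi hch.1
  have hr := LinearMap.finrank_range_add_finrank_ker (choi Φ).mulVecLin
  simp at hr
  obtain ⟨f, hf⟩ := exists_linearIndependent_of_le_finrank
    (show 3 ≤ Module.finrank ℂ (LinearMap.range (choi Φ).mulVecLin) by omega)
  have hpre : ∀ k, ∃ y, choi Φ *ᵥ y = f k := fun k => (f k).2
  -- If the rank were at least three, `W` would have three independent columns in the range of the
  -- Choi matrix. The perturbations considered are `W h Wᴴ` with `h` Hermitian.
  choose y hy using hpre
  set Y : Matrix (Fin 2 × Fin 2) (Fin 3) ℂ := Matrix.of fun p k => y k p with hY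
  set W := choi Φ * Y with hW
  have hWinj : Function.Injective W.mulVec := by
    rw [Matrix.mulVec_injective_iff]
    have : W.col = fun k => (f k : Fin 2 × Fin 2 → ℂ) := by
      funext k p
      rw [← hy k]
      rfl
    rw [this]
    exact hf.map' (Submodule.subtype _) (Submodule.ker_subtype _)
  have hcancel : ∀ {m : Type} (M : Matrix (Fin 3) m ℂ), W * M = 0 → M = 0 := by
    intro m M hM
    ext i j
    have h1 : W.mulVec (fun k => M k j) = W.mulVec 0 := by
      ext p
      have := congr_fun₂ hM p j
      simpa [Matrix.mul_apply, Matrix.mulVec, dotProduct] using this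
    exact congr_fun (hWinj h1) i
  -- `L` is the partial trace over the output of `W h Wᴴ`; where it vanishes, the perturbation
  -- preserves the trace.
  let L : Matrix (Fin 3) (Fin 3) ℂ →ₗ[ℂ] M2 :=
    { toFun := fun h => Matrix.of fun i j => ∑ a, (W * h * Wᴴ) (i, a) (j, a)
      map_add' := fun g h => by
        ext i j
        simp only [Matrix.mul_add, Matrix.add_mul, Matrix.add_apply, Matrix.of_apply,
          Finset.sum_add_distrib]
      map_smul' := fun c h => by
        ext i j
        simp only [Matrix.mul_smul, Matrix.smul_mul, Matrix.smul_apply, Matrix.of_apply,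
          smul_eq_mul, Finset.mul_sum, RingHom.id_apply] }
  have hL : ∀ h i j, L h i j = ∑ a, (W * h * Wᴴ) (i, a) (j, a) := fun _ _ _ => rfl
  have hLstar : ∀ h, L hᴴ = (L h)ᴴ := fun h => by
    ext i j
    have e : W * hᴴ * Wᴴ = (W * h * Wᴴ)ᴴ := by
      simp only [Matrix.conjTranspose_mul, Matrix.conjTranspose_conjTranspose, Matrix.mul_assoc]
    rw [Matrix.conjTranspose_apply, hL, hL, e, star_sum]
    rfl
  have hzero : ∀ h : Matrix (Fin 3) (Fin 3) ℂ, h.IsHermitian → L h = 0 → h = 0 := by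
    intro h hh hLh
    obtain ⟨B, hB⟩ : ∃ B : Matrix (Fin 2 × Fin 2) (Fin 2 × Fin 2) ℂ, choi Φ = star B * B := by
      open scoped MatrixOrder Matrix.Norms.L2Operator in
      exact CStarAlgebra.nonneg_iff_eq_star_mul_self.mp hC.nonneg
    rw [Matrix.star_eq_conjTranspose] at hB
    -- With the Choi matrix equal to `Bᴴ B`, the perturbed one is `Bᴴ (1 ± δK) B`, which is positive
    -- for small δ. Extremality then gives `W h Wᴴ = 0`, and injectivity of `W` gives `h = 0`.
    set K := B * (Y * h * Yᴴ) * Bᴴ with hK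
    have hKh : K.IsHermitian := by
      rw [hK, Matrix.IsHermitian]
      simp only [Matrix.conjTranspose_mul, Matrix.conjTranspose_conjTranspose, Matrix.mul_assoc,
        hh.eq]
    have hWK : W * h * Wᴴ = Bᴴ * K * B := by
      rw [hW, Matrix.conjTranspose_mul, hC.1.eq, hB, hK]
      simp only [Matrix.mul_assoc]
    obtain ⟨δ, hδ, hp, hm⟩ := exists_posSemidef_one_add_smul hKh
    have hmem : ∀ c : ℂ, (1 + c • K).PosSemidef → Φ + ofChoi (c • (W * h * Wᴴ)) ∈ channels := by
      intro c hc
      refine ⟨isCompletelyPositive_of_posSemidef_choi ?_, fun X => ?_⟩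
      · have e : choi (Φ + ofChoi (c • (W * h * Wᴴ))) = Bᴴ * (1 + c • K) * B := by
          have e1 : choi (Φ + ofChoi (c • (W * h * Wᴴ)))
              = choi Φ + choi (ofChoi (c • (W * h * Wᴴ))) := rfl
          rw [e1, choi_ofChoi, hWK, hB, Matrix.mul_add, Matrix.add_mul, Matrix.mul_one,
            Matrix.mul_smul, Matrix.smul_mul]
        rw [e]
        exact hc.conjTranspose_mul_mul_same B
      · rw [LinearMap.add_apply, Matrix.trace_add, hch.2]
        have e : (ofChoi (c • (W * h * Wᴴ)) X).trace = ∑ i, ∑ j, X i j * (c * L h i j) := by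
          rw [Matrix.trace_fin_two]
          simp only [ofChoi_apply, hL, Fin.sum_univ_two, Matrix.smul_apply, smul_eq_mul]
          ring
        rw [e, hLh]
        simp
    have h1 := hmem δ hp
    have h2 := hmem (-δ) (by rw [neg_smul, ← sub_eq_add_neg]; exact hm)
    have e2 : ofChoi ((-δ : ℂ) • (W * h * Wᴴ)) = -ofChoi ((δ : ℂ) • (W * h * Wᴴ)) := by
      refine LinearMap.ext fun X => ?_
      ext i j
      simp [ofChoi_apply, Fin.sum_univ_two]
      ring
    rw [e2, ← sub_eq_add_neg] at h2
    have h3 := eq_zero_of_perturbation hΦ h1 h2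
    have h4 := congr_arg choi h3
    rw [choi_ofChoi] at h4
    have h5 : (δ : ℂ) • (W * h * Wᴴ) = 0 := h4.trans rfl
    have h6 : W * h * Wᴴ = 0 := (smul_eq_zero.mp h5).resolve_left (by exact_mod_cast hδ.ne')
    rw [Matrix.mul_assoc] at h6
    have h7 := hcancel _ h6
    have h8 := congr_arg Matrix.conjTranspose h7
    rw [Matrix.conjTranspose_mul, Matrix.conjTranspose_conjTranspose, hh.eq,
      Matrix.conjTranspose_zero] at h8
    exact hcancel _ h8
  -- Dimension count, 9 against 4. The kernel is stable under adjoints, so the Hermitian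
  -- combinations `h + hᴴ` and `i(h − hᴴ)` lie in it too.
  have hker : LinearMap.ker L ≠ ⊥ := by
    refine LinearMap.ker_ne_bot_of_finrank_lt ?_
    rw [Module.finrank_matrix, Module.finrank_matrix]
    simp
  obtain ⟨h, hh, hne⟩ := (Submodule.ne_bot_iff _).mp hker
  have hLh : L h = 0 := hh
  have hLh' : L hᴴ = 0 := by rw [hLstar, hLh, Matrix.conjTranspose_zero]
  have h1 := hzero (h + hᴴ) (Matrix.isHermitian_add_transpose_self h) (by rw [map_add, hLh, hLh', add_zero])
  have h2 := hzero (Complex.I • (h - hᴴ)) (by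
    rw [Matrix.IsHermitian, Matrix.conjTranspose_smul, Matrix.conjTranspose_sub,
      Matrix.conjTranspose_conjTranspose]
    simp [sub_eq_add_neg, add_comm]) (by rw [map_smul, map_sub, hLh, hLh', sub_zero, smul_zero])
  have h3 : h - hᴴ = 0 := (smul_eq_zero.mp h2).resolve_left Complex.I_ne_zero
  refine hne ?_
  have h4 : (2 : ℂ) • h = 0 := by
    calc (2 : ℂ) • h = (h + hᴴ) + (h - hᴴ) := by module
      _ = 0 := by rw [h1, h3, add_zero]
  exact (smul_eq_zero.mp h4).resolve_left two_ne_zero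

/-- Every extremal channel maps some pure state to a pure state. -/
lemma exists_pureStates_of_extremal {Φ : M2 →ₗ[ℂ] M2} (hΦ : Φ ∈ extremalChannels) :
    ∃ ρ ∈ pureStates, Φ ρ ∈ pureStates := by
  obtain ⟨f, hf⟩ := exists_linearIndependent_of_le_finrank (two_le_finrank_ker_choi hΦ)
  have hmem : ∀ k, choi Φ *ᵥ (f k : Fin 2 × Fin 2 → ℂ) = 0 := fun k => (f k).2
  have hli := hf.map' (Submodule.subtype _) (Submodule.ker_subtype _)
  set v : Fin 2 × Fin 2 → ℂ := (f 0).1 with hv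
  set w : Fin 2 × Fin 2 → ℂ := (f 1).1 with hw
  have hli' : ∀ s t : ℂ, s • v + t • w = 0 → s = 0 ∧ t = 0 := by
    intro s t hst
    have := Fintype.linearIndependent_iff.mp hli ![s, t] (by simpa [Fin.sum_univ_two] using hst)
    exact ⟨this 0, this 1⟩
  have hch := extremal_subset_channels hΦ
  -- The determinant along v + z w is a quadratic in z with leading coefficient `A`. It has a
  -- complex root unless `A = 0`, and then `w` itself is a product vector.
  set A := w (0, 0) * w (1, 1) - w (0, 1) * w (1, 0) with hA
  by_cases hA0 : A = 0
  · refine exists_pureStates_of_choi_ker hch (v := w) (fun h0 => ?_) (hmem 1) (sub_eq_zero.mp hA0)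
    have := (hli' 0 1 (by simp [h0])).2
    exact one_ne_zero this
  · set b := v (0, 0) * w (1, 1) + w (0, 0) * v (1, 1) - v (0, 1) * w (1, 0) - w (0, 1) * v (1, 0)
      with hb
    set c := v (0, 0) * v (1, 1) - v (0, 1) * v (1, 0) with hc
    obtain ⟨r, hr⟩ := IsAlgClosed.exists_eq_mul_self (discrim A b c)
    obtain ⟨z, hz⟩ := exists_quadratic_eq_zero hA0 ⟨r, hr⟩
    refine exists_pureStates_of_choi_ker hch (v := v + z • w) (fun h0 => ?_) ?_ ?_
    · have := (hli' 1 z (by simpa using h0)).1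
      exact one_ne_zero this
    · rw [Matrix.mulVec_add, Matrix.mulVec_smul, hmem, hmem, smul_zero, add_zero]
    · simp only [Pi.add_apply, Pi.smul_apply, smul_eq_mul]
      rw [hA, hb, hc] at hz
      linear_combination hz

/-! ### Classification of the extremal channels -/

lemma poleMap_mem_unitaryChannels {u : ℂ} (hu : Complex.normSq u = 1) :
    poleMap u 0 1 ∈ unitaryChannels := by
  have huu : u * (starRingEnd ℂ) u = 1 := by rw [Complex.mul_conj, hu, Complex.ofReal_one]
  have huu' : (starRingEnd ℂ) u * u = 1 := by rw [mul_comm, huu]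
  refine ⟨!![1, 0; 0, star u], ?_, LinearMap.ext fun X => ?_⟩
  · rw [Matrix.mem_unitaryGroup_iff]
    ext i j
    fin_cases i <;> fin_cases j <;> simp [Matrix.mul_apply, Fin.sum_univ_two, huu']
  · rw [poleMap_apply, conjBy_apply]
    ext i j
    fin_cases i <;> fin_cases j <;> simp only [Matrix.mul_apply, Fin.sum_univ_two,
      Matrix.conjTranspose_apply] <;> simp
    · ring
    · linear_combination -(X 1 1) * huu'

/-- A rotation about the z-axis absorbs the phase of `b`. -/
lemma unitarilyEquivalent_onePO (b : ℂ) :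
    UnitarilyEquivalent (poleMap b 0 (Complex.normSq b)) (onePO ‖b‖) := by
  have hu : Complex.normSq (Complex.exp (b.arg * Complex.I)) = 1 := by
    rw [Complex.normSq_eq_norm_sq, Complex.norm_exp_ofReal_mul_I, one_pow]
  refine unitarilyEquivalent_iff.mpr ⟨_, 1, poleMap_mem_unitaryChannels hu,
    one_mem_unitaryChannels, ?_⟩
  rw [mul_one, onePO_eq_poleMap, poleMap_mul, Complex.normSq_eq_norm_sq, mul_comm,
    Complex.norm_mul_exp_arg_mul_I]
  simp

lemma eq_of_poleMap_perturbation {b y e f : ℂ} {s : ℝ} (h : poleMap b y s ∈ extremalChannels)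
    (h1 : PoleCond (b + e) (y + f) s) (h2 : PoleCond (b - e) (y - f) s) : e = 0 ∧ f = 0 := by
  have he : ((1 / 2 : ℝ) : ℂ) • poleMap (b + e) (y + f) s
      + ((1 / 2 : ℝ) : ℂ) • poleMap (b - e) (y - f) s = poleMap b y s := by
    refine LinearMap.ext fun X => ?_
    simp only [LinearMap.add_apply, LinearMap.smul_apply, poleMap_apply]
    ext i j
    fin_cases i <;> fin_cases j <;> simp <;> ring
  have := (mem_extremalChannels_iff.mp h).2 _ (poleMap_mem_channels h1) _ (poleMap_mem_channels h2)
    (1 / 2) (1 / 2) (by norm_num) (by norm_num) (by norm_num) he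
  obtain ⟨h3, h4, -⟩ := poleMap_injective this
  exact ⟨by simpa using h3, by simpa using h4⟩

/-- Equality in the last constraint yields a second pure state with pure image besides the pole; the
inner product of the two strictly increases because s < 1. -/
lemma exists_twoPO_of_poleMap {b y : ℂ} {s : ℝ} (hc : PoleCond b y s) (hs : s < 1) (hy : y ≠ 0)
    (heq : Complex.normSq y = (1 - s) * (s - Complex.normSq b)) :
    ∃ ω θ : ℝ, 0 ≤ θ ∧ θ < ω ∧ ω < Real.pi / 2 ∧
      UnitarilyEquivalent (poleMap b y s) (twoPO ω θ) := by
  have hy' : 0 < Complex.normSq y := Complex.normSq_pos.mpr hy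
  set d := s - Complex.normSq b with hd
  have hd0 : 0 < d := by
    rw [heq] at hy'
    exact pos_of_mul_pos_right hy' (by linarith)
  have hb0 := Complex.normSq_nonneg b
  have hs0 : 0 < s := by linarith
  set w := star b * y with hw
  have hww : w.re ^ 2 + w.im ^ 2 = Complex.normSq b * Complex.normSq y := by
    have : Complex.normSq w = Complex.normSq b * Complex.normSq y := by
      rw [hw, map_mul]; simp
    rw [← this, Complex.normSq_apply]; ring
  have hbw : b * w = Complex.normSq b * y := by
    rw [hw, ← mul_assoc, RCLike.star_def, Complex.mul_conj]
  set N := Complex.normSq b * Complex.normSq y + d ^ 2 with hN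
  have hN0 : 0 < N := by positivity
  -- The projection onto (b̄y, d)/√N with d = s − |b|². The assumption `y ≠ 0` makes d positive,
  -- hence ρ differs from the pole.
  set ρ := bloch (2 * w.re * d / N) (-(2 * w.im * d / N)) (1 - 2 * d ^ 2 / N) with hρdef
  have hρ : ρ ∈ pureStates := by
    rw [bloch_mem_pureStates_iff]
    field_simp
    linear_combination 4 * d ^ 2 * hww + 4 * d ^ 2 * hN
  have hmap : poleMap b y s ρ
      = bloch (2 * y.re * d * s / N) (-(2 * y.im * d * s / N)) (1 - 2 * (s * d ^ 2) / N) := by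
    have hNC : (N : ℂ) ≠ 0 := by exact_mod_cast hN0.ne'
    have hw1 : (w.re : ℂ) + w.im * Complex.I = w := Complex.re_add_im w
    have hy1 : (y.re : ℂ) + y.im * Complex.I = y := Complex.re_add_im y
    have hw2 : (w.re : ℂ) - w.im * Complex.I = (starRingEnd ℂ) w := by
      apply Complex.ext <;> simp
    have hy2 : (y.re : ℂ) - y.im * Complex.I = (starRingEnd ℂ) y := by
      apply Complex.ext <;> simp
    have hbw' : (starRingEnd ℂ) b * (starRingEnd ℂ) w = Complex.normSq b * (starRingEnd ℂ) y := by
      rw [← map_mul, hbw, map_mul, Complex.conj_ofReal]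
    have hsd : (s : ℂ) = d + Complex.normSq b := by rw [hd]; push_cast; ring
    rw [poleMap_apply]
    ext i j
    fin_cases i <;> fin_cases j <;> simp [ρ, bloch]
    · ring
    · field_simp
      linear_combination b * hw1 + hbw - (s : ℂ) * hy1 - y * hsd
    · field_simp
      linear_combination (starRingEnd ℂ) b * hw2 + hbw' - (s : ℂ) * hy2
        - (starRingEnd ℂ) y * hsd
    · ring
  have hmap' : poleMap b y s ρ ∈ pureStates := by
    rw [hmap, bloch_mem_pureStates_iff]
    have hyy : y.re ^ 2 + y.im ^ 2 = Complex.normSq y := by rw [Complex.normSq_apply]; ring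
    have hNs : N - s * d ^ 2 = Complex.normSq y * s := by
      have : Complex.normSq b = s - d := by rw [hd]; ring
      rw [hN, this, heq]; ring
    field_simp
    linear_combination 4 * d ^ 2 * s ^ 2 * hyy - 4 * s * d ^ 2 * hNs
  have hp := poleMap_pole b y s
  have hlt : blochInner (bloch 0 0 1) ρ < blochInner (poleMap b y s (bloch 0 0 1)) (poleMap b y s ρ) := by
    rw [hp, hmap, hρdef, blochInner_bloch, blochInner_bloch]
    have : s * d ^ 2 / N < d ^ 2 / N := by
      rw [div_lt_div_iff_of_pos_right hN0]
      have : 0 < d ^ 2 := by positivity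
      nlinarith
    have e1 : 2 * d ^ 2 / N = 2 * (d ^ 2 / N) := by ring
    have e2 : 2 * (s * d ^ 2) / N = 2 * (s * d ^ 2 / N) := by ring
    rw [e1, e2]
    linarith
  have hne : poleMap b y s (bloch 0 0 1) ≠ poleMap b y s ρ := by
    rw [hp, hmap]
    intro he
    have := (bloch_injective he).2.2
    have : 0 < 2 * (s * d ^ 2) / N := by positivity
    linarith
  obtain ⟨ω, θ, h0, h1, h2, -, -, h3⟩ := exists_unitarilyEquivalent_twoPO
    (poleMap_mem_channels hc) pole_mem_pureStates hρ (by rw [hp]; exact pole_mem_pureStates)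
    hmap' hlt hne
  exact ⟨ω, θ, h0, h1, h2, h3⟩

/-- The classification of the extremal qubit channels. -/
theorem extremal_classification {Φ : Module.End ℂ M2} (hΦ : Φ ∈ extremalChannels) :
    Φ ∈ unitaryChannels ∨ (∃ lam : ℝ, 0 ≤ lam ∧ lam < 1 ∧ UnitarilyEquivalent Φ (onePO lam)) ∨
      ∃ ω θ : ℝ, 0 ≤ θ ∧ θ < ω ∧ ω < Real.pi / 2 ∧ UnitarilyEquivalent Φ (twoPO ω θ) := by
  obtain ⟨ρ, hρ, hρ'⟩ := exists_pureStates_of_extremal hΦ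
  obtain ⟨U, hU, hU1⟩ := exists_unitary_pole hρ
  obtain ⟨V, hV, hV1⟩ := exists_unitary_pole hρ'
  obtain ⟨U', hU', -, hUU⟩ := exists_inverse hU
  have hue : UnitarilyEquivalent (V * Φ * U') Φ :=
    unitarilyEquivalent_iff.mpr ⟨V, U', hV, hU', rfl⟩
  have hext := hue.mem_extremalChannels hΦ
  have hfix : (V * Φ * U') (bloch 0 0 1) = bloch 0 0 1 := by
    have : U' (U ρ) = ρ := LinearMap.congr_fun hUU ρ
    rw [← hU1, Module.End.mul_apply, this, Module.End.mul_apply, hV1, hU1]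
  obtain ⟨b, y, s, hc, hbys⟩ := exists_poleMap (extremal_subset_channels hext) hfix
  rw [hbys] at hue hext
  have hb2 := Complex.normSq_eq_norm_sq b
  have hy2 := Complex.normSq_eq_norm_sq y
  rcases hc.le_one.eq_or_lt with rfl | hs
  · left
    have hy : y = 0 := by
      have := hc.normSq_le_mul
      rw [sub_self, zero_mul] at this
      exact Complex.normSq_eq_zero.mp (le_antisymm this (Complex.normSq_nonneg _))
    subst hy
    have hb : Complex.normSq b = 1 := by
      refine le_antisymm hc.normSq_le ?_
      have hb1 : ‖b‖ ≤ 1 := by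
        have := hc.normSq_le
        rw [hb2] at this
        exact (sq_le_one_iff₀ (norm_nonneg b)).mp this
      -- Moving `b` by ±(1 − ‖b‖) stays in the unit disc, so extremality forces ‖b‖ = 1. Below, `y`
      -- is moved in the same way inside its disc of radius `R`.
      have hn : ‖((1 - ‖b‖ : ℝ) : ℂ)‖ = 1 - ‖b‖ := by
        rw [Complex.norm_real, Real.norm_of_nonneg (by linarith)]
      have hcond : ∀ w : ℂ, ‖w‖ ≤ 1 → PoleCond w 0 1 := fun w hw =>
        ⟨le_rfl, by rw [Complex.normSq_eq_norm_sq]; exact (sq_le_one_iff₀ (norm_nonneg w)).mpr hw,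
          by simp⟩
      have := (eq_of_poleMap_perturbation (e := ((1 - ‖b‖ : ℝ) : ℂ)) (f := 0) hext
        (by rw [add_zero]; exact hcond _ ((norm_add_le _ _).trans (by rw [hn]; linarith)))
        (by rw [sub_zero]; exact hcond _ ((norm_sub_le _ _).trans (by rw [hn]; linarith)))).1
      have h3 : 1 - ‖b‖ = 0 := by exact_mod_cast this
      rw [hb2, ← sub_eq_zero.mp h3]; norm_num
    obtain ⟨W, Z, hW, hZ, h⟩ := unitarilyEquivalent_iff.mp hue.symm
    rw [h]
    exact mul_mem_unitaryChannels (mul_mem_unitaryChannels hW (poleMap_mem_unitaryChannels hb)) hZ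
  · right
    have heq : Complex.normSq y = (1 - s) * (s - Complex.normSq b) := by
      have hR0 : 0 ≤ (1 - s) * (s - Complex.normSq b) :=
        (Complex.normSq_nonneg y).trans hc.normSq_le_mul
      have hyR : ‖y‖ ≤ √((1 - s) * (s - Complex.normSq b)) := by
        refine Real.le_sqrt_of_sq_le ?_
        rw [← hy2]; exact hc.normSq_le_mul
      set R := √((1 - s) * (s - Complex.normSq b)) with hR
      have hn : ‖((R - ‖y‖ : ℝ) : ℂ)‖ = R - ‖y‖ := by
        rw [Complex.norm_real, Real.norm_of_nonneg (by linarith)]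
      have hcond : ∀ w : ℂ, ‖w‖ ≤ R → PoleCond b w s := fun w hw => by
        refine ⟨hc.le_one, hc.normSq_le, ?_⟩
        rw [Complex.normSq_eq_norm_sq w, ← Real.sq_sqrt hR0, ← hR]
        exact pow_le_pow_left₀ (norm_nonneg w) hw 2
      have := (eq_of_poleMap_perturbation (e := 0) (f := ((R - ‖y‖ : ℝ) : ℂ)) hext
        (by rw [add_zero]; exact hcond _ ((norm_add_le _ _).trans (by rw [hn]; linarith)))
        (by rw [sub_zero]; exact hcond _ ((norm_sub_le _ _).trans (by rw [hn]; linarith)))).2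
      have h3 : R - ‖y‖ = 0 := by exact_mod_cast this
      rw [hy2, ← sub_eq_zero.mp h3, hR, Real.sq_sqrt hR0]
    by_cases hy : y = 0
    · left
      subst hy
      have hsb : s = Complex.normSq b := by
        rw [map_zero] at heq
        have := (mul_eq_zero.mp heq.symm).resolve_left (by linarith)
        linarith
      rw [hsb] at hue hs
      refine ⟨‖b‖, norm_nonneg b, ?_, hue.symm.trans (unitarilyEquivalent_onePO b)⟩
      rw [hb2] at hs
      exact (sq_lt_one_iff₀ (norm_nonneg b)).mp hs
    · right
      obtain ⟨ω, θ, h0, h1, h2, h3⟩ := exists_twoPO_of_poleMap hc hs hy heq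
      exact ⟨ω, θ, h0, h1, h2, hue.symm.trans h3⟩

/-! ### Sufficiency -/

/-- Compositions of at least one element of `F`. -/
def IsComposition (F : Set (M2 →ₗ[ℂ] M2)) (Φ : Module.End ℂ M2) : Prop :=
  ∃ l : List (Module.End ℂ M2), l ≠ [] ∧ (∀ Ψ ∈ l, Ψ ∈ F) ∧ Φ = l.prod

lemma IsComposition.of_mem {F : Set (M2 →ₗ[ℂ] M2)} {Φ : Module.End ℂ M2} (h : Φ ∈ F) :
    IsComposition F Φ := ⟨[Φ], by simp, by simpa using h, by simp⟩

lemma IsComposition.mul {F : Set (M2 →ₗ[ℂ] M2)} {Φ Ψ : Module.End ℂ M2} (h : IsComposition F Φ)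
    (h' : IsComposition F Ψ) : IsComposition F (Φ * Ψ) := by
  obtain ⟨l, h1, h2, rfl⟩ := h
  obtain ⟨m, -, h4, rfl⟩ := h'
  refine ⟨l ++ m, by simp [h1], fun Ψ hΨ => ?_, by simp⟩
  rcases List.mem_append.mp hΨ with hΨ | hΨ
  · exact h2 Ψ hΨ
  · exact h4 Ψ hΨ

lemma IsComposition.pow {F : Set (M2 →ₗ[ℂ] M2)} {Φ : Module.End ℂ M2} (h : IsComposition F Φ)
    (n : ℕ) : IsComposition F (Φ ^ (n + 1)) := by
  induction n with
  | zero => simpa using h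
  | succ n ih => rw [_root_.pow_succ]; exact ih.mul h

lemma onePO_pow (lam : ℝ) (n : ℕ) : (onePO lam : Module.End ℂ M2) ^ n = onePO (lam ^ n) := by
  induction n with
  | zero =>
    rw [pow_zero, pow_zero, onePO_eq_poleMap]
    refine LinearMap.ext fun X => ?_
    rw [poleMap_apply]
    ext i j
    fin_cases i <;> fin_cases j <;> simp
  | succ n ih =>
    rw [_root_.pow_succ, ih, onePO_eq_poleMap, onePO_eq_poleMap, poleMap_mul, onePO_eq_poleMap]
    congr 1
    · push_cast; ring
    · simp
    · ring

lemma diagonalForm_mul (a b c t a' b' c' t' : ℝ) :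
    (diagonalForm a b c t * diagonalForm a' b' c' t' : Module.End ℂ M2)
      = diagonalForm (a * a') (b * b') (c * c') (c * t' + t) := by
  refine ext_pureStates fun ρ hρ => ?_
  obtain ⟨x, y, z, -, rfl⟩ := mem_pureStates_iff.mp hρ
  rw [Module.End.mul_apply]
  simp only [diagonalForm_bloch]
  congr 1 <;> ring

/-- The pure outputs of the inner channel are the pure inputs of the outer one, so angles
concatenate; the diagonal entries telescope. -/
lemma twoPO_mul {ω m θ : ℝ} (h0 : 0 ≤ θ) (h1 : θ < m) (h2 : m < ω) (h3 : ω < Real.pi / 2) :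
    (twoPO ω m * twoPO m θ : Module.End ℂ M2) = twoPO ω θ := by
  obtain ⟨hC, hc, hS, hs, -, -⟩ := trig_facts h0 (h1.trans h2) h3
  obtain ⟨hCm, -, hSm, -, -, -⟩ := trig_facts h0 h1 (h2.trans h3)
  have ht : Real.tan m ≠ 0 := by
    rw [Real.tan_eq_sin_div_cos]; positivity
  have hT : Real.tan ω ≠ 0 := by
    rw [Real.tan_eq_sin_div_cos]; positivity
  rw [twoPO, twoPO, diagonalForm_mul, twoPO]
  congr 1
  · field_simp
  · field_simp
  · field_simp
  · rw [Real.tan_eq_sin_div_cos, Real.tan_eq_sin_div_cos]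
    field_simp
    ring

section Sufficiency

variable {ε : ℝ}

/-- A high root of `lam` is close to 1. The bound max(1 − ε, 0) allows for ε > 1. -/
lemma isComposition_onePO {F : Set (M2 →ₗ[ℂ] M2)} (hε : 0 < ε) (hF : family1PO ε ⊆ F) {lam : ℝ}
    (h0 : 0 ≤ lam) (h1 : lam < 1) : IsComposition F (onePO lam) := by
  rcases h0.eq_or_lt with rfl | h0
  · exact .of_mem (hF ⟨0, Or.inr rfl, rfl⟩)
  have hr0 : 0 ≤ max (1 - ε) 0 := le_max_right _ _
  have hr1 : max (1 - ε) 0 < 1 := max_lt (by linarith) one_pos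
  obtain ⟨n, hn⟩ := exists_pow_lt_of_lt_one h0 hr1
  have hn' : max (1 - ε) 0 ^ (n + 1) < lam :=
    (pow_le_pow_of_le_one hr0 hr1.le n.le_succ).trans_lt hn
  set μ := lam ^ ((((n + 1 : ℕ) : ℝ))⁻¹) with hμ
  have hpow : μ ^ (n + 1) = lam := Real.rpow_inv_natCast_pow h0.le n.succ_ne_zero
  have hμ0 : 0 < μ := Real.rpow_pos_of_pos h0 _
  have hlt : max (1 - ε) 0 < μ := lt_of_pow_lt_pow_left₀ (n + 1) hμ0.le (by rw [hpow]; exact hn')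
  have hμ1 : μ < 1 := lt_of_pow_lt_pow_left₀ (n + 1) zero_le_one (by rw [hpow, one_pow]; exact h1)
  rw [← hpow, ← onePO_pow]
  exact (IsComposition.of_mem (hF ⟨μ, Or.inl ⟨hμ0, hμ1, (le_max_left _ _).trans_lt hlt⟩, rfl⟩)).pow n

/-- Bisect the interval from θ to ω repeatedly. -/
lemma isComposition_twoPO_pos {F : Set (M2 →ₗ[ℂ] M2)} (hF : family2PO ε ⊆ F) (n : ℕ) :
    ∀ ω θ : ℝ, 0 < θ → θ < ω → ω < Real.pi / 2 → ω - θ < 2 ^ n * ε →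
      IsComposition F (twoPO ω θ) := by
  induction n with
  | zero =>
    intro ω θ h0 h1 h2 h3
    exact .of_mem (hF (Or.inr ⟨(ω, θ), ⟨h0, h1, h2, by simpa using h3⟩, rfl⟩))
  | succ n ih =>
    intro ω θ h0 h1 h2 h3
    have hm1 : θ < (ω + θ) / 2 := by linarith
    have hm2 : (ω + θ) / 2 < ω := by linarith
    rw [_root_.pow_succ] at h3
    rw [← twoPO_mul h0.le hm1 hm2 h2]
    exact (ih _ _ (by linarith) hm2 h2 (by linarith)).mul
      (ih _ _ h0 hm1 (by linarith) (by linarith))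

lemma isComposition_twoPO {F : Set (M2 →ₗ[ℂ] M2)} (hε : 0 < ε) (hF : family2PO ε ⊆ F) {ω θ : ℝ}
    (h0 : 0 ≤ θ) (h1 : θ < ω) (h2 : ω < Real.pi / 2) : IsComposition F (twoPO ω θ) := by
  have hpos : ∀ θ, 0 < θ → θ < ω → IsComposition F (twoPO ω θ) := fun θ h0 h1 => by
    obtain ⟨n, hn⟩ := pow_unbounded_of_one_lt ((ω - θ) / ε) (one_lt_two (α := ℝ))
    exact isComposition_twoPO_pos hF n ω θ h0 h1 h2 ((div_lt_iff₀ hε).mp hn)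
  rcases h0.eq_or_lt with rfl | h0
  -- A start at θ = 0 needs one short degenerate step, applied first; the rest has a positive
  -- starting angle.
  · have hm : 0 < min ε ω := lt_min hε h1
    have hm1 : min ε ω / 2 < ω := by linarith [min_le_right ε ω]
    rw [← twoPO_mul le_rfl (half_pos hm) hm1 h2]
    refine (hpos _ (half_pos hm) hm1).mul (.of_mem (hF (Or.inl ⟨min ε ω / 2, ?_, rfl⟩)))
    exact ⟨half_pos hm, by linarith, by linarith [min_le_left ε ω]⟩
  · exact hpos θ h0 h1

lemma IsComposition.of_unitarilyEquivalent {F : Set (M2 →ₗ[ℂ] M2)} (hF : unitaryChannels ⊆ F)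
    {Φ Ψ : Module.End ℂ M2} (h : UnitarilyEquivalent Φ Ψ) (hΨ : IsComposition F Ψ) :
    IsComposition F Φ := by
  obtain ⟨U, V, hU, hV, rfl⟩ := unitarilyEquivalent_iff.mp h
  exact ((IsComposition.of_mem (hF hU)).mul hΨ).mul (.of_mem (hF hV))

theorem isUniversalFor_families (hε : 0 < ε) :
    IsUniversalFor (unitaryChannels ∪ family1PO ε ∪ family2PO ε) extremalChannels := by
  refine ⟨?_, fun Φ hΦ => ?_⟩
  · rintro _ ((h | ⟨lam, (h | h), rfl⟩) | (⟨ω, h, rfl⟩ | ⟨p, h, rfl⟩))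
    · exact unitaryChannels_subset_channels h
    · exact onePO_mem_channels h.1.le h.2.1.le
    · rw [Set.mem_singleton_iff.mp h]
      exact onePO_mem_channels le_rfl zero_le_one
    · exact twoPO_mem_channels le_rfl h.1 h.2.1
    · exact twoPO_mem_channels h.1.le h.2.1 h.2.2.1
  · change IsComposition _ Φ
    have hu : unitaryChannels ⊆ unitaryChannels ∪ family1PO ε ∪ family2PO ε :=
      Set.subset_union_left.trans Set.subset_union_left
    rcases extremal_classification hΦ with h | ⟨lam, h0, h1, h⟩ | ⟨ω, θ, h0, h1, h2, h⟩
    · exact .of_mem (hu h)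
    · exact .of_unitarilyEquivalent hu h (isComposition_onePO hε
        (Set.subset_union_right.trans Set.subset_union_left) h0 h1)
    · exact .of_unitarilyEquivalent hu h
        (isComposition_twoPO hε Set.subset_union_right h0 h1 h2)

end Sufficiency

/-! ### Necessity -/

/-- Tracking of pure states: if a composition of two channels maps two pure states to different
pure states, then so does the inner channel. -/
lemma mem_pureStates_of_mul {A B : Module.End ℂ M2} (hA : A ∈ channels) (hB : B ∈ channels)
    {ρ σ : M2} (hρ : ρ ∈ densityMatrices) (hσ : σ ∈ densityMatrices) (hρ' : A (B ρ) ∈ pureStates)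
    (hne : A (B ρ) ≠ A (B σ)) : B ρ ∈ pureStates := by
  by_contra hmix
  have hc := eq_constantChannel hA (map_mem_densityMatrices hB hρ) hmix hρ'
  refine hne ?_
  have := congr_arg (fun Ψ : M2 →ₗ[ℂ] M2 => Ψ (B σ)) hc
  simp only [constantChannel_apply, (map_mem_densityMatrices hB hσ).2, one_smul] at this
  exact this.symm

/-- The head of the list acts last. If the tail produces a mixed state, the head sends it to a pure
state and is constant. Otherwise all outputs of the tail are pure, and averaging two inputs shows
that the tail is constant. -/
lemma exists_constantChannel_of_prod {l : List (Module.End ℂ M2)} (hl : ∀ Ψ ∈ l, Ψ ∈ channels)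
    {ψ : M2} (hψ : ψ ∈ pureStates) (h : ∀ ρ ∈ densityMatrices, l.prod ρ = ψ) :
    ∃ ξ ∈ pureStates, constantChannel ξ ∈ l := by
  induction l generalizing ψ with
  | nil =>
    exfalso
    have e1 := h _ (bloch_mem_densityMatrices_iff (x := 0) (y := 0) (z := 1) |>.mpr (by norm_num))
    have e2 := h _ (bloch_mem_densityMatrices_iff (x := 0) (y := 0) (z := 0) |>.mpr (by norm_num))
    have : bloch 0 0 1 = bloch 0 0 0 := e1.trans e2.symm
    exact one_ne_zero (bloch_injective this).2.2
  | cons A l ih =>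
    have hA := hl A (by simp)
    have hl' : ∀ Ψ ∈ l, Ψ ∈ channels := fun Ψ hΨ => hl Ψ (by simp [hΨ])
    have hB := prod_mem_channels hl'
    simp only [List.prod_cons, Module.End.mul_apply] at h
    by_cases hpure : ∀ ρ ∈ densityMatrices, l.prod ρ ∈ pureStates
    · have hmid := bloch_mem_densityMatrices_iff (x := 0) (y := 0) (z := 1) |>.mpr (by norm_num)
      obtain ⟨ξ, hξ, hm⟩ := ih hl' (hpure _ hmid) fun ρ hρ => by
        have havg : ((1 / 2 : ℝ) : ℂ) • ρ + ((1 / 2 : ℝ) : ℂ) • bloch 0 0 1 ∈ densityMatrices := by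
          obtain ⟨x, y, z, hr, rfl⟩ := mem_densityMatrices_iff.mp hρ
          have e : ((1 / 2 : ℝ) : ℂ) • bloch x y z + ((1 / 2 : ℝ) : ℂ) • bloch 0 0 1
              = bloch (x / 2) (y / 2) ((z + 1) / 2) := by
            ext i j
            fin_cases i <;> fin_cases j <;> simp [bloch] <;> ring
          rw [e, bloch_mem_densityMatrices_iff]
          nlinarith [sq_nonneg (z - 1)]
        obtain ⟨e1, e2⟩ := eq_of_convex_combination (hpure _ havg)
          (map_mem_densityMatrices hB hρ) (map_mem_densityMatrices hB hmid)
          (one_half_pos) (one_half_pos) (by rw [map_add, map_smul, map_smul])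
        rw [e1, e2]
      exact ⟨ξ, hξ, by simp [hm]⟩
    · push Not at hpure
      obtain ⟨ρ, hρ, hmix⟩ := hpure
      have hp : A (l.prod ρ) ∈ pureStates := by rw [h ρ hρ]; exact hψ
      have hc := eq_constantChannel hA (map_mem_densityMatrices hB hρ) hmix hp
      exact ⟨_, hp, by rw [← hc]; simp⟩

/-- If a composition raises the Bloch inner product of two pure states from at most `c` to more than
`c`, then one of the channels does so, with inner products in the same range. -/
lemma exists_increasing_step {l : List (Module.End ℂ M2)} (hl : ∀ Ψ ∈ l, Ψ ∈ channels)
    {ρ σ : M2} (hρ : ρ ∈ pureStates) (hσ : σ ∈ pureStates) (hρ' : l.prod ρ ∈ pureStates)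
    (hσ' : l.prod σ ∈ pureStates) (hne : l.prod ρ ≠ l.prod σ)
    (c : ℝ) (hc : blochInner ρ σ ≤ c) (hc' : c < blochInner (l.prod ρ) (l.prod σ)) :
    ∃ A ∈ l, ∃ τ ∈ pureStates, ∃ υ ∈ pureStates, A τ ∈ pureStates ∧ A υ ∈ pureStates ∧ A τ ≠ A υ ∧
      blochInner ρ σ ≤ blochInner τ υ ∧ blochInner τ υ ≤ c ∧ c < blochInner (A τ) (A υ) ∧
      blochInner (A τ) (A υ) ≤ blochInner (l.prod ρ) (l.prod σ) := by
  induction l with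
  | nil =>
    simp only [List.prod_nil, Module.End.one_apply] at hc'
    linarith
  | cons A l ih =>
    have hA := hl A (by simp)
    have hl' : ∀ Ψ ∈ l, Ψ ∈ channels := fun Ψ hΨ => hl Ψ (by simp [hΨ])
    have hB := prod_mem_channels hl'
    simp only [List.prod_cons, Module.End.mul_apply] at hρ' hσ' hne hc' ⊢
    have h1 := mem_pureStates_of_mul hA hB hρ.1 hσ.1 hρ' hne
    have h2 := mem_pureStates_of_mul hA hB hσ.1 hρ.1 hσ' hne.symm
    have hmono := blochInner_le hA h1 h2 hρ' hσ'
    -- Either the threshold is crossed at the last channel applied or already within the tail.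
    by_cases hm : blochInner (l.prod ρ) (l.prod σ) ≤ c
    · exact ⟨A, by simp, _, h1, _, h2, hρ', hσ', hne, blochInner_le hB hρ hσ h1 h2, hm, hc', le_rfl⟩
    · obtain ⟨B, hBm, τ, hτ, υ, hυ, k1, k2, k3, k4, k5, k6, k7⟩ := ih hl' h1 h2
        (fun he => hne (congr_arg A he)) (not_le.mp hm)
      exact ⟨B, by simp [hBm], τ, hτ, υ, hυ, k1, k2, k3, k4, k5, k6, k7.trans hmono⟩

/-- The threshold is the initial inner product itself. By monotonicity the factor that crosses it
starts from exactly this value, so θ is preserved, and it ends no higher than the final value. -/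
lemma exists_twoPO_of_prod {l : List (Module.End ℂ M2)} (hl : ∀ Ψ ∈ l, Ψ ∈ channels) {ω θ : ℝ}
    (h0 : 0 ≤ θ) (h1 : θ < ω) (h2 : ω < Real.pi / 2) (h : twoPO ω θ = l.prod) :
    ∃ A ∈ l, ∃ ω' θ' : ℝ, θ' = θ ∧ θ < ω' ∧ ω' ≤ ω ∧ UnitarilyEquivalent A (twoPO ω' θ') := by
  obtain ⟨hC, hc, hS, hs, hsS, hCc⟩ := trig_facts h0 h1 h2
  have e1 := twoPO_bloch_pos h0 h1 h2
  have e2 := twoPO_bloch_neg h0 h1 h2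
  rw [h] at e1 e2
  obtain ⟨A, hA, τ, hτ, υ, hυ, k1, k2, k3, k4, k5, k6, k7⟩ := exists_increasing_step hl
    (bloch_cos_mem_pureStates θ) (bloch_neg_cos_mem_pureStates θ)
    (by rw [e1]; exact bloch_cos_mem_pureStates ω)
    (by rw [e2]; exact bloch_neg_cos_mem_pureStates ω)
    (by rw [e1, e2]; exact bloch_cos_ne hC) (2 * Real.sin θ ^ 2 - 1)
    (by rw [blochInner_cos]) (by rw [e1, e2, blochInner_cos]; nlinarith)
  rw [blochInner_cos] at k4
  rw [e1, e2, blochInner_cos] at k7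
  have hin : blochInner τ υ = 2 * Real.sin θ ^ 2 - 1 := le_antisymm k5 k4
  obtain ⟨ω', θ', h0', h1', h2', i1, i2, hue⟩ := exists_unitarilyEquivalent_twoPO (hl A hA) hτ hυ
    k1 k2 (by rw [hin]; exact k6) k3
  obtain ⟨-, -, hS', hs', -, -⟩ := trig_facts h0' h1' h2'
  have hpi := Real.pi_pos
  have hθ : θ' = θ := by
    have : Real.sin θ' = Real.sin θ := by
      have : Real.sin θ' ^ 2 = Real.sin θ ^ 2 := by linarith
      exact (sq_eq_sq₀ hs' hs).mp this
    exact Real.injOn_sin ⟨by linarith, by linarith⟩ ⟨by linarith, by linarith⟩ this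
  refine ⟨A, hA, ω', θ', hθ, by rw [← hθ]; exact h1', ?_, hue⟩
  by_contra! hlt
  have := Real.sin_lt_sin_of_lt_of_le_pi_div_two (by linarith) h2'.le hlt
  nlinarith

/-- The factors of a channel that is unitarily equivalent to some `onePO` are of the same form. -/
lemma exists_onePO_of_mul {A B : Module.End ℂ M2} (hA : A ∈ channels) (hB : B ∈ channels) {lam : ℝ}
    (h0 : 0 < lam) (h : UnitarilyEquivalent (A * B) (onePO lam)) :
    ∃ μ ν : ℝ, 0 < μ ∧ μ ≤ 1 ∧ 0 < ν ∧ ν ≤ 1 ∧ μ * ν = lam ∧ UnitarilyEquivalent A (onePO μ) ∧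
      UnitarilyEquivalent B (onePO ν) := by
  obtain ⟨U, V, hU, hV, hUV⟩ := unitarilyEquivalent_iff.mp h.symm
  have hUc := unitaryChannels_subset_channels hU
  have hBV := mul_mem_channels hB (unitaryChannels_subset_channels hV)
  have hUA := mul_mem_channels hUc hA
  have hcomp : ∀ X, (U * A) ((B * V) X) = onePO lam X := fun X => by
    rw [hUV]; rfl
  have hpole : onePO lam (bloch 0 0 1) = bloch 0 0 1 := by rw [onePO_eq_poleMap, poleMap_pole]
  have hp0 : (B * V) (bloch 0 0 1) ∈ pureStates := by
    refine mem_pureStates_of_mul hUA hBV (σ := bloch 0 0 (-1)) pole_mem_pureStates.1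
      (bloch_mem_densityMatrices_iff.mpr (by norm_num)) ?_ ?_
    · rw [hcomp, hpole]; exact pole_mem_pureStates
    · rw [hcomp, hcomp, hpole, onePO, diagonalForm_bloch]
      intro he
      have := (bloch_injective he).2.2
      nlinarith
  obtain ⟨W, hW, hW1⟩ := exists_unitary_pole hp0
  obtain ⟨W', hW', -, hWW⟩ := exists_inverse hW
  have hinv : ∀ X, W' (W X) = X := fun X => LinearMap.congr_fun hWW X
  have hB' : (W * (B * V)) (bloch 0 0 1) = bloch 0 0 1 := hW1
  have hA' : ((U * A) * W') (bloch 0 0 1) = bloch 0 0 1 := by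
    rw [← hW1, Module.End.mul_apply, hinv, hcomp, hpole, hW1]
  obtain ⟨b, y, s, hc, e1⟩ := exists_poleMap
    (mul_mem_channels hUA (unitaryChannels_subset_channels hW')) hA'
  obtain ⟨b', y', s', hc', e2⟩ := exists_poleMap
    (mul_mem_channels (unitaryChannels_subset_channels hW) hBV) hB'
  have hprod : (poleMap b y s * poleMap b' y' s' : Module.End ℂ M2) = onePO lam := by
    rw [← e1, ← e2]
    refine LinearMap.ext fun X => ?_
    rw [← hcomp X]
    exact congr_arg (U * A) (hinv _)
  rw [poleMap_mul, onePO_eq_poleMap] at hprod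
  obtain ⟨p1, -, p3⟩ := poleMap_injective hprod
  -- Both factors satisfy |b|² ≤ s. Equality for the positive product forces equality for each, and
  -- then the last constraint kills `y` and `y'`.
  have hnorm : Complex.normSq b * Complex.normSq b' = s * s' := by
    rw [p3, ← map_mul, p1, Complex.normSq_ofReal, sq]
  have hb0 := Complex.normSq_nonneg b
  have hb0' := Complex.normSq_nonneg b'
  have hss : 0 < s * s' := by rw [p3]; positivity
  have hs0 : 0 < s := by
    refine lt_of_le_of_ne (hb0.trans hc.normSq_le) fun h => ?_
    rw [← h, zero_mul] at hss
    exact lt_irrefl _ hss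
  have hs0' : 0 < s' := pos_of_mul_pos_right hss hs0.le
  have n1 := hc.normSq_le
  have n2 := hc'.normSq_le
  have q1 : s = Complex.normSq b := by
    refine le_antisymm ?_ n1
    have : s * s' ≤ Complex.normSq b * s' := by
      rw [← hnorm]; exact mul_le_mul_of_nonneg_left n2 hb0
    exact le_of_mul_le_mul_right this hs0'
  have q2 : s' = Complex.normSq b' := by
    refine le_antisymm ?_ n2
    have : s * s' ≤ s * Complex.normSq b' := by
      rw [← hnorm]; exact mul_le_mul_of_nonneg_right n1 hb0'
    exact le_of_mul_le_mul_left this hs0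
  have hyz : ∀ {b y : ℂ} {s : ℝ}, PoleCond b y s → s = Complex.normSq b → y = 0 := by
    intro b y s hc hs
    have := hc.normSq_le_mul
    rw [hs, sub_self, mul_zero] at this
    exact Complex.normSq_eq_zero.mp (le_antisymm this (Complex.normSq_nonneg _))
  have r1 := hyz hc q1
  have r2 := hyz hc' q2
  have l1 := hc.le_one
  have l2 := hc'.le_one
  rw [r1, q1] at e1
  rw [r2, q2] at e2
  rw [q1, Complex.normSq_eq_norm_sq] at hs0 l1
  rw [q2, Complex.normSq_eq_norm_sq] at hs0' l2
  have t1 := (unitarilyEquivalent_onePO b)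
  have t2 := (unitarilyEquivalent_onePO b')
  rw [← e1] at t1
  rw [← e2] at t2
  refine ⟨‖b‖, ‖b'‖, ?_, ?_, ?_, ?_, ?_, ?_, ?_⟩
  · exact lt_of_le_of_ne (norm_nonneg b) fun h => by rw [← h] at hs0; norm_num at hs0
  · exact (sq_le_one_iff₀ (norm_nonneg b)).mp l1
  · exact lt_of_le_of_ne (norm_nonneg b') fun h => by rw [← h] at hs0'; norm_num at hs0'
  · exact (sq_le_one_iff₀ (norm_nonneg b')).mp l2
  · rw [← norm_mul, p1, Complex.norm_real, Real.norm_of_nonneg h0.le]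
  · exact (unitarilyEquivalent_iff.mpr ⟨U, W', hU, hW', rfl⟩).symm.trans t1
  · have : UnitarilyEquivalent (W * (B * V)) B :=
      unitarilyEquivalent_iff.mpr ⟨W, V, hW, hV, by rw [mul_assoc]⟩
    exact this.symm.trans t2

lemma exists_onePO_of_prod {l : List (Module.End ℂ M2)} (hl : ∀ Ψ ∈ l, Ψ ∈ channels)
    (hne : l ≠ []) {lam : ℝ} (h0 : 0 < lam) (h1 : lam < 1)
    (h : UnitarilyEquivalent l.prod (onePO lam)) :
    ∃ A ∈ l, ∃ μ : ℝ, lam ≤ μ ∧ μ < 1 ∧ UnitarilyEquivalent A (onePO μ) := by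
  induction l with
  | nil => exact absurd rfl hne
  | cons A l ih =>
    have hA := hl A (by simp)
    have hl' : ∀ Ψ ∈ l, Ψ ∈ channels := fun Ψ hΨ => hl Ψ (by simp [hΨ])
    rcases eq_or_ne l [] with rfl | hl0
    · exact ⟨A, by simp, lam, le_rfl, h1, by simpa using h⟩
    rw [List.prod_cons] at h
    obtain ⟨μ, ν, hμ, hμ1, hν, hν1, hprod, hAe, hBe⟩ :=
      exists_onePO_of_mul hA (prod_mem_channels hl') h0 h
    rcases hμ1.eq_or_lt with rfl | hlt
    · rw [one_mul] at hprod
      rw [hprod] at hBe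
      obtain ⟨B, hB, κ, k1, k2, k3⟩ := ih hl' hl0 hBe
      exact ⟨B, by simp [hB], κ, k1, k2, k3⟩
    · exact ⟨A, by simp, μ, by nlinarith, hlt, hAe⟩

/-- On a nonempty finite set `f` would attain a positive minimum. -/
lemma infinite_of_small_values {α : Type*} {S : Set α} (f : α → ℝ) (hpos : ∀ x ∈ S, 0 < f x)
    (hsmall : ∀ δ > 0, ∃ x ∈ S, f x < δ) : S.Infinite := by
  intro hfin
  obtain ⟨x₀, hx₀, -⟩ := hsmall 1 one_pos
  obtain ⟨x, hx, hmin⟩ := Set.exists_min_image S f hfin ⟨x₀, hx₀⟩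
  obtain ⟨y, hy, hlt⟩ := hsmall (f x) (hpos x hx)
  exact absurd (hmin y hy) (not_le.mpr hlt)

lemma exists_pos_le_min {δ ε : ℝ} (hδ : 0 < δ) (hε : 0 < ε) :
    ∃ κ : ℝ, 0 < κ ∧ κ ≤ δ ∧ κ ≤ ε ∧ κ ≤ 1 :=
  ⟨min (min δ ε) 1, lt_min (lt_min hδ hε) one_pos, (min_le_left _ _).trans (min_le_left _ _),
    (min_le_left _ _).trans (min_le_right _ _), min_le_right _ _⟩

section Necessity

variable {T F : Set (M2 →ₗ[ℂ] M2)}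

lemma exists_constantChannel_mem (hT : extremalChannels ⊆ T) (hF : IsUniversalFor F T) :
    ∃ ψ ∈ pureStates, constantChannel ψ ∈ F ∩ extremal1POdeg := by
  obtain ⟨l, -, hl, h⟩ := hF.2 _ (hT (onePO_mem_extremalChannels le_rfl zero_le_one))
  obtain ⟨ψ, hψ, hm⟩ := exists_constantChannel_of_prod (fun Ψ hΨ => hF.1 (hl Ψ hΨ))
    pole_mem_pureStates fun ρ hρ => by
      rw [← h]
      obtain ⟨x, y, z, -, rfl⟩ := mem_densityMatrices_iff.mp hρ
      rw [onePO, diagonalForm_bloch]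
      simp
  exact ⟨ψ, hψ, hl _ hm, constantChannel_mem_extremal1POdeg hψ (hF.1 (hl _ hm))⟩

lemma infinite_onePO (hT : extremalChannels ⊆ T) (hF : IsUniversalFor F T) {ε : ℝ} (hε : 0 < ε) :
    {lam ∈ params1POnd ε | ∃ Φ ∈ F ∩ extremal1POnd,
      UnitarilyEquivalent Φ (onePO lam)}.Infinite := by
  refine infinite_of_small_values (fun lam => 1 - lam) (fun lam h => ?_) fun δ hδ => ?_
  · have := h.1.2.1
    linarith
  · obtain ⟨κ, hκ0, hκδ, hκε, hκ1⟩ := exists_pos_le_min hδ hε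
    have h0 : 0 < 1 - κ / 2 := by linarith
    have h1 : 1 - κ / 2 < 1 := by linarith
    obtain ⟨l, hne, hl, h⟩ := hF.2 _ (hT (onePO_mem_extremalChannels h0.le h1.le))
    obtain ⟨A, hA, μ, h1, h2, h3⟩ := exists_onePO_of_prod (fun Ψ hΨ => hF.1 (hl Ψ hΨ)) hne
      h0 h1 (h ▸ UnitarilyEquivalent.refl (onePO (1 - κ / 2)))
    have hμ0 : 0 < μ := by linarith
    exact ⟨μ, ⟨⟨hμ0, h2, by linarith⟩, A, ⟨hl A hA, h3.mem_extremal1POnd hμ0 h2⟩, h3⟩, by linarith⟩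

lemma infinite_twoPO_zero (hT : extremalChannels ⊆ T) (hF : IsUniversalFor F T) {ε : ℝ}
    (hε : 0 < ε) : {ω ∈ params2POdeg ε | ∃ Φ ∈ F ∩ extremal2POdeg,
      UnitarilyEquivalent Φ (twoPO ω 0)}.Infinite := by
  refine infinite_of_small_values (fun ω => ω) (fun ω h => h.1.1) fun δ hδ => ?_
  obtain ⟨κ, hκ0, hκδ, hκε, hκ1⟩ := exists_pos_le_min hδ hε
  have hpi : κ / 2 < Real.pi / 2 := by linarith [Real.pi_gt_three]
  obtain ⟨l, -, hl, h⟩ := hF.2 _ (hT (twoPO_mem_extremalChannels le_rfl (half_pos hκ0) hpi))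
  obtain ⟨A, hA, ω', θ', rfl, h1, h2, h3⟩ := exists_twoPO_of_prod (fun Ψ hΨ => hF.1 (hl Ψ hΨ))
    le_rfl (half_pos hκ0) hpi h
  have hω : ω' < Real.pi / 2 := h2.trans_lt hpi
  exact ⟨ω', ⟨⟨h1, hω, by linarith⟩, A, ⟨hl A hA, h3.mem_extremal2POdeg h1 hω⟩, h3⟩, by linarith⟩

lemma infinite_twoPO (hT : extremalChannels ⊆ T) (hF : IsUniversalFor F T) {ε : ℝ}
    (hε : 0 < ε) : {p ∈ params2POnd ε | ∃ Φ ∈ F ∩ extremal2POnd,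
      UnitarilyEquivalent Φ (twoPO p.1 p.2)}.Infinite := by
  refine infinite_of_small_values (fun p => p.1 - p.2) (fun p h => ?_) fun δ hδ => ?_
  · have := h.1.2.1
    linarith
  obtain ⟨κ, hκ0, hκδ, hκε, hκ1⟩ := exists_pos_le_min hδ hε
  -- The starting angle 1 is an arbitrary point of (0, π/2), kept fixed while ω tends to it; κ ≤ 1
  -- keeps ω below 3/2.
  have hpi : 1 + κ / 4 < Real.pi / 2 := by linarith [Real.pi_gt_three]
  have h01 : (0 : ℝ) < 1 := one_pos
  have hlt : 1 < 1 + κ / 4 := by linarith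
  obtain ⟨l, -, hl, h⟩ := hF.2 _ (hT (twoPO_mem_extremalChannels h01.le hlt hpi))
  obtain ⟨A, hA, ω', θ', rfl, h1, h2, h3⟩ := exists_twoPO_of_prod (fun Ψ hΨ => hF.1 (hl Ψ hΨ))
    h01.le hlt hpi h
  have hω : ω' < Real.pi / 2 := h2.trans_lt hpi
  exact ⟨(ω', 1), ⟨⟨h01, h1, hω, by dsimp only; linarith⟩, A,
    ⟨hl A hA, h3.mem_extremal2POnd h01 h1 hω⟩, h3⟩, by dsimp only; linarith⟩

end Necessity

end QubitChannel

theorem theorem5p19 :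
    -- the `ε`-small set is universal for the extremal channels
    (∀ ε : ℝ, 0 < ε →
      QubitChannel.IsUniversalFor
        (QubitChannel.unitaryChannels ∪ QubitChannel.family1PO ε ∪ QubitChannel.family2PO ε)
        QubitChannel.extremalChannels) ∧
    -- necessity, for a set `F` that is universal for all channels, or for any class `T` of
    -- channels that contains the extremal ones
    (∀ T F : Set (QubitChannel.M2 →ₗ[ℂ] QubitChannel.M2),
      T ⊆ QubitChannel.channels → QubitChannel.extremalChannels ⊆ T →
      QubitChannel.IsUniversalFor F T →
        (∃ ψ ∈ QubitChannel.pureStates,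
          QubitChannel.constantChannel ψ ∈ F ∩ QubitChannel.extremal1POdeg) ∧
        ∀ ε : ℝ, 0 < ε →
          {lam ∈ QubitChannel.params1POnd ε | ∃ Φ ∈ F ∩ QubitChannel.extremal1POnd,
            QubitChannel.UnitarilyEquivalent Φ (QubitChannel.onePO lam)}.Infinite ∧
          {ω ∈ QubitChannel.params2POdeg ε | ∃ Φ ∈ F ∩ QubitChannel.extremal2POdeg,
            QubitChannel.UnitarilyEquivalent Φ (QubitChannel.twoPO ω 0)}.Infinite ∧
          {p ∈ QubitChannel.params2POnd ε | ∃ Φ ∈ F ∩ QubitChannel.extremal2POnd,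
            QubitChannel.UnitarilyEquivalent Φ (QubitChannel.twoPO p.1 p.2)}.Infinite) :=
  ⟨fun _ hε => QubitChannel.isUniversalFor_families hε, fun _ _ _ hT hF =>
    ⟨QubitChannel.exists_constantChannel_mem hT hF, fun _ hε =>
      ⟨QubitChannel.infinite_onePO hT hF hε, QubitChannel.infinite_twoPO_zero hT hF hε,
        QubitChannel.infinite_twoPO hT hF hε⟩⟩⟩
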